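/- Let $\mathbb D$ be the open unit disc and $H^\infty$ the algebra of bounded analytic functions on $\mathbb D$ with the norm $\|f\|_\infty=\sup_{\mathbb D}|f|$. A function $\Theta\in H^\infty$ is *inner* if it has radial limits of modulus $1$ at almost every point of $\partial\mathbb D$; let $\mathcal Z(\Theta)\subset\mathbb D$ be its zero set. Equip the quotient algebra $H^\infty/\Theta H^\infty$ with the norm $\|[f]\|=\inf\{\|f+g\Theta\|_\infty: g\in H^\infty\}$. The inner function $\Theta$ satisfies the *Sharp Invertibility Property* (SIP) if for any $\varepsilon>0$ there exists $\delta>0$ such that for any $f\in H^\infty$, the conditions $\|[f]\|\le 1$ and $\inf_{\mathcal Z(\Theta)}|f|\ge 1-\delta$ (a void condition if $\mathcal Z(\Theta)=\emptyset$) imply that $[f]$ is invertible in $H^\infty/\Theta H^\infty$ and $\|[f]^{-1}\|\le 1+\varepsilon$. Let $\rho(z,w)=\left|\dfrac{z-w}{1-\bar w z}\right|$. A finite or infinite sequence $\{a_k\}\subset\mathbb D$ is *super-separated* if for any $\delta>0$ there exists $N\in\mathbb N$ such that $\rho(a_j,a_k)\ge 1-\delta$ for all indices $j>k\ge N$. **Proposition.**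 Let $\Theta$ be an inner function that satisfies the SIP, and let $\{a_k\}$ be the (empty, finite or infinite) sequence of its zeros in $\mathbb D$, each repeated according to its multiplicity. Assume that $\{a_k\}$ is super-separated. Then $\Theta$ is a thin Blaschke product; that is, $\sum_k(1-|a_k|)<\infty$, there is a constant $c$ with $|c|=1$ such that $$\Theta(z)=c\prod_k b_{a_k}(z),\quad z\in\mathbb D,\qquad b_a(z)=\frac{\bar a}{|a|}\,\frac{a-z}{1-\bar a z}\ (a\ne0),\quad b_0(z)=z,$$ and, if the sequence is infinite, $$\lim_{k\to\infty}(1-|a_k|^2)\,|\Theta'(a_k)|=1 .$$ In particular $\Theta$ has no non-trivial singular inner factor: every zero-free inner function that divides $\Theta$ in $H^\infty$ is constant. -/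

import Mathlib

open Set Filter Topology MeasureTheory Metric BoundedContinuousFunction

/-- The open unit disc of the complex plane. -/
abbrev Disc : Type := ball (0 : ℂ) 1

/-- A function on the disc, regarded as a function on `ℂ` (zero outside the disc), so that
Mathlib's notions `DifferentiableOn`, `deriv`, `analyticOrderAt` apply to it. -/
noncomputable def discExt (f : Disc → ℂ) : ℂ → ℂ := Function.extend Subtype.val f 0

theorem discExt_apply (f : Disc → ℂ) {z : ℂ} (hz : z ∈ ball (0 : ℂ) 1) :
    discExt f z = f ⟨z, hz⟩ :=
  Subtype.val_injective.extend_apply f 0 (⟨z, hz⟩ : Disc)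

/-- The algebra `H^∞` of bounded analytic functions on the disc, with the supremum norm (inherited
from the algebra of bounded continuous functions on the disc). -/
noncomputable def HInf : Subalgebra ℂ (Disc →ᵇ ℂ) where
  carrier := {f | DifferentiableOn ℂ (discExt f) (ball (0 : ℂ) 1)}
  mul_mem' {f g} hf hg := (DifferentiableOn.mul hf hg).congr fun z hz => by
    simp [discExt_apply _ hz]
  add_mem' {f g} hf hg := (DifferentiableOn.add hf hg).congr fun z hz => by
    simp [discExt_apply _ hz]
  algebraMap_mem' c := (differentiableOn_const c).congr fun z hz => by
    rw [discExt_apply _ hz]; rfl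

noncomputable instance HInf.instNormedCommRing : NormedCommRing HInf := inferInstance

/-- The value of `f ∈ H^∞` at `z`; meaningful for `z` in the disc. -/
noncomputable def HInf.eval (f : HInf) : ℂ → ℂ := discExt (f : Disc →ᵇ ℂ)

/-- `Θ ∈ H^∞` is inner if it has radial limits of modulus one at almost every boundary point. -/
def IsInner (Θ : HInf) : Prop :=
  ∀ᵐ θ : ℝ, ∃ ζ : ℂ, ‖ζ‖ = 1 ∧
    Tendsto (fun r : ℝ => HInf.eval Θ (r * Complex.exp (θ * Complex.I))) (𝓝[<] 1) (𝓝 ζ)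

/-- The zero set of `Θ` in the disc. -/
def zeroSet (Θ : HInf) : Set ℂ := {z | z ∈ ball (0 : ℂ) 1 ∧ HInf.eval Θ z = 0}

/-- The quotient algebra `H^∞ / Θ H^∞`; its norm (supplied by Mathlib) is the quotient norm
`‖[f]‖ = inf {‖f + g Θ‖ : g ∈ H^∞}`. -/
def QuotAlg (Θ : HInf) : Type := HInf ⧸ Ideal.span {Θ}

noncomputable instance QuotAlg.instSeminormedCommRing (Θ : HInf) :
    SeminormedCommRing (QuotAlg Θ) :=
  inferInstanceAs (SeminormedCommRing (HInf ⧸ Ideal.span {Θ}))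

/-- The class `[f]` of `f` in `H^∞ / Θ H^∞`. -/
noncomputable def quotClass (Θ : HInf) : HInf →+* QuotAlg Θ := Ideal.Quotient.mk (Ideal.span {Θ})

/-- The Sharp Invertibility Property. The condition `inf_{zeroSet Θ} |f| ≥ 1 - δ` is void when `Θ`
has no zeros. -/
def SharpInvertibility (Θ : HInf) : Prop :=
  ∀ ε : ℝ, 0 < ε → ∃ δ : ℝ, 0 < δ ∧ ∀ f : HInf,
    ‖quotClass Θ f‖ ≤ 1 → (∀ z ∈ zeroSet Θ, 1 - δ ≤ ‖HInf.eval f z‖) →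
      ∃ u : (QuotAlg Θ)ˣ, (u : QuotAlg Θ) = quotClass Θ f ∧
        ‖((u⁻¹ : (QuotAlg Θ)ˣ) : QuotAlg Θ)‖ ≤ 1 + ε

/-- The pseudohyperbolic distance. -/
noncomputable def pseudoDist (z w : ℂ) : ℝ := ‖(z - w) / (1 - (starRingEnd ℂ) w * z)‖

/-- The index set `{k ∈ ℕ : k < N}` of a finite (`N < ∞`, possibly `N = 0`) or infinite (`N = ∞`)
sequence. -/
abbrev SeqIdx (N : ℕ∞) : Type := {k : ℕ // (k : ℕ∞) < N}

/-- The finite or infinite sequence `a` enumerates the zeros of `Θ` in the disc, each one repeated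
according to its multiplicity. -/
def IsZeroSequence (Θ : HInf) {N : ℕ∞} (a : SeqIdx N → Disc) : Prop :=
  ∀ z : Disc, {k | a k = z}.encard = analyticOrderAt (HInf.eval Θ) (z : ℂ)

/-- Super-separated sequences. -/
def IsSuperSeparated {N : ℕ∞} (a : SeqIdx N → Disc) : Prop :=
  ∀ δ : ℝ, 0 < δ → ∃ M : ℕ, ∀ j k : SeqIdx N, M ≤ (k : ℕ) → (k : ℕ) < (j : ℕ) →
    1 - δ ≤ pseudoDist (a j) (a k)

open Classical in
/-- The Blaschke factor with zero `a`. -/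
noncomputable def blaschkeFactor (a z : ℂ) : ℂ :=
  if a = 0 then z
  else (starRingEnd ℂ) a / (‖a‖ : ℂ) * ((a - z) / (1 - (starRingEnd ℂ) a * z))

/-- `Θ` is the Blaschke product with zero sequence `a`, up to a unimodular constant: `a` satisfies
the Blaschke condition, and the product of the factors converges to `Θ` up to the constant. -/
def IsBlaschkeProduct (Θ : HInf) {N : ℕ∞} (a : SeqIdx N → Disc) : Prop :=
  Summable (fun k => 1 - ‖(a k : ℂ)‖) ∧
  ∃ c : ℂ, ‖c‖ = 1 ∧ ∀ z ∈ ball (0 : ℂ) 1,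
    Multipliable (fun k => blaschkeFactor (a k) z) ∧
    HInf.eval Θ z = c * ∏' k, blaschkeFactor (a k) z

/-- `Θ` is a thin Blaschke product with zero sequence `a`. Convergence along `cofinite` is
convergence as `k → ∞` when the sequence is infinite, and is void when it is finite. -/
def IsThinBlaschkeProduct (Θ : HInf) {N : ℕ∞} (a : SeqIdx N → Disc) : Prop :=
  IsBlaschkeProduct Θ a ∧
  Tendsto (fun k => (1 - ‖(a k : ℂ)‖ ^ 2) * ‖deriv (HInf.eval Θ) (a k)‖) cofinite (𝓝 1)

/-- `Θ` has no non-trivial singular inner factor: the zero-free inner functions that divide `Θ`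
in `H^∞` are constant. -/
def HasNoSingularFactor (Θ : HInf) : Prop :=
  ∀ S : HInf, IsInner S → zeroSet S = ∅ → S ∣ Θ →
    ∃ c : ℂ, ∀ z ∈ ball (0 : ℂ) 1, HInf.eval S z = c

/-! ### The pseudohyperbolic distance -/

/-! The argument converts the SIP into a lower bound for `|Θ|`, which minimum modulus arguments then
carry to quotients of `Θ`.

Test the SIP on a Blaschke factor `b` with zero `z₀` hyperbolically far from the zeros of `Θ`. Then
`b h = 1 + g Θ` with `‖h‖ ≤ M`, `M` close to `1`, and `g Θ = -1` at `z₀`. The triangle inequality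
would only give `|Θ(z₀)| ≥ 1 / (1 + M)`. Instead, apply to `G = 1 + g Θ` the Möbius map of `{|w| <
M}` onto the unit disc sending `1` to `0`. The result is divisible by `Θ`; dividing by an inner
function does not increase the norm, so `|Θ(z₀)| ≥ 1 / M` (`one_div_le_norm_eval`). Hence `|Θ|` is
close to `1` far from the zeros.

If the zero `a_k` is far from the others, write `Θ = b_k X`. On a large pseudohyperbolic circle
around `a_k` the bound for `Θ` passes to `X`, and inside `X` is zero-free, so it persists there
(`le_norm_of_eq_blaschkeFactor_mul`). At `a_k` itself this is thinness.

Let `Q_s` be the quotient of `Θ` by a finite subproduct. On a suitable circle `|z| = r` each point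
is either far from all zeros or near one isolated zero, so `|Q_s|` is close to `1` there. For large
`s` the disc inside contains no zeros of `Q_s`, and the bound extends inward
(`exists_finset_le_norm`). Thus `|Q_s(z₀)| → 1` at a point with `Θ(z₀) ≠ 0`, and Schwarz–Pick makes
`Q_s` converge to a unimodular constant. -/

theorem one_sub_conj_mul_ne_zero {w z : ℂ} (hw : ‖w‖ < 1) (hz : ‖z‖ < 1) :
    1 - (starRingEnd ℂ) w * z ≠ 0 := by
  intro h
  have h1 : ‖(starRingEnd ℂ) w * z‖ = 1 := by
    rw [← sub_eq_zero.1 h, norm_one]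
  rw [norm_mul, RCLike.norm_conj] at h1
  nlinarith [norm_nonneg w, norm_nonneg z]

theorem norm_one_sub_conj_mul_sq_sub (z w : ℂ) :
    ‖1 - (starRingEnd ℂ) w * z‖ ^ 2 - ‖z - w‖ ^ 2 = (1 - ‖z‖ ^ 2) * (1 - ‖w‖ ^ 2) := by
  simp only [Complex.sq_norm, Complex.normSq_apply, Complex.sub_re, Complex.sub_im, Complex.one_re,
    Complex.one_im, Complex.mul_re, Complex.mul_im, Complex.conj_re, Complex.conj_im]
  ring

theorem pseudoDist_nonneg (z w : ℂ) : 0 ≤ pseudoDist z w := norm_nonneg _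

theorem one_sub_pseudoDist_sq {z w : ℂ} (hz : ‖z‖ < 1) (hw : ‖w‖ < 1) :
    1 - pseudoDist z w ^ 2 =
      (1 - ‖z‖ ^ 2) * (1 - ‖w‖ ^ 2) / ‖1 - (starRingEnd ℂ) w * z‖ ^ 2 := by
  have h := norm_pos_iff.2 (one_sub_conj_mul_ne_zero hw hz)
  rw [pseudoDist, norm_div, ← norm_one_sub_conj_mul_sq_sub, div_pow, sub_div,
    div_self (pow_ne_zero 2 h.ne')]

theorem one_sub_norm_sq_pos {z : ℂ} (hz : ‖z‖ < 1) : 0 < 1 - ‖z‖ ^ 2 := by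
  nlinarith [norm_nonneg z]

theorem pseudoDist_lt_one {z w : ℂ} (hz : ‖z‖ < 1) (hw : ‖w‖ < 1) : pseudoDist z w < 1 := by
  have h := norm_pos_iff.2 (one_sub_conj_mul_ne_zero hw hz)
  have h1 : 0 < 1 - pseudoDist z w ^ 2 := by
    rw [one_sub_pseudoDist_sq hz hw]
    have := one_sub_norm_sq_pos hz
    have := one_sub_norm_sq_pos hw
    positivity
  nlinarith [pseudoDist_nonneg z w]

theorem norm_one_sub_conj_mul_comm (z w : ℂ) :
    ‖1 - (starRingEnd ℂ) w * z‖ = ‖1 - (starRingEnd ℂ) z * w‖ := by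
  rw [← RCLike.norm_conj]
  simp [mul_comm]

theorem pseudoDist_comm (z w : ℂ) : pseudoDist z w = pseudoDist w z := by
  rw [pseudoDist, pseudoDist, norm_div, norm_div, norm_one_sub_conj_mul_comm, norm_sub_rev]

theorem pseudoDist_self (z : ℂ) : pseudoDist z z = 0 := by simp [pseudoDist]

theorem one_sub_norm_le_norm_one_sub_conj_mul {z w : ℂ} (hw : ‖w‖ ≤ 1) :
    1 - ‖z‖ ≤ ‖1 - (starRingEnd ℂ) w * z‖ := by
  have h1 : ‖(starRingEnd ℂ) w * z‖ ≤ ‖z‖ := by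
    rw [norm_mul, RCLike.norm_conj]
    nlinarith [norm_nonneg z]
  have := norm_sub_norm_le (1 : ℂ) ((starRingEnd ℂ) w * z)
  rw [norm_one] at this
  linarith

/-- Quantifies that a point near the unit circle is far from every point of a compact subset of the
disc. -/
theorem one_sub_pseudoDist_sq_le {z w : ℂ} (hz : ‖z‖ < 1) (hw : ‖w‖ < 1) :
    1 - pseudoDist z w ^ 2 ≤ (1 - ‖w‖ ^ 2) * (2 / (1 - ‖z‖)) := by
  have h := one_sub_norm_le_norm_one_sub_conj_mul (z := z) hw.le
  have hz' : 0 < 1 - ‖z‖ := by linarith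
  have h2 : (1 - ‖z‖) ^ 2 ≤ ‖1 - (starRingEnd ℂ) w * z‖ ^ 2 := by gcongr
  have hw' := one_sub_norm_sq_pos hw
  have hz2 := one_sub_norm_sq_pos hz
  rw [one_sub_pseudoDist_sq hz hw]
  calc (1 - ‖z‖ ^ 2) * (1 - ‖w‖ ^ 2) / ‖1 - (starRingEnd ℂ) w * z‖ ^ 2
      ≤ (1 - ‖z‖ ^ 2) * (1 - ‖w‖ ^ 2) / (1 - ‖z‖) ^ 2 := by gcongr
    _ = (1 - ‖w‖ ^ 2) * ((1 + ‖z‖) / (1 - ‖z‖)) := by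
        have := hz'.ne'
        field_simp
        ring
    _ ≤ (1 - ‖w‖ ^ 2) * (2 / (1 - ‖z‖)) := by
        gcongr
        linarith

/-- Converse estimate, which yields the Blaschke condition from distances to a single point. -/
theorem one_sub_norm_le_one_sub_pseudoDist {z w : ℂ} (hz : ‖z‖ < 1) (hw : ‖w‖ < 1) :
    1 - ‖w‖ ≤ 8 / (1 - ‖z‖ ^ 2) * (1 - pseudoDist z w) := by
  have hw' := one_sub_norm_sq_pos hw
  have hz' := one_sub_norm_sq_pos hz
  have hpos := norm_pos_iff.2 (one_sub_conj_mul_ne_zero hw hz)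
  have h1 : ‖1 - (starRingEnd ℂ) w * z‖ ≤ 2 := by
    calc _ ≤ ‖(1 : ℂ)‖ + ‖(starRingEnd ℂ) w * z‖ := norm_sub_le _ _
      _ ≤ 1 + 1 := by
        rw [norm_one, norm_mul, RCLike.norm_conj]
        gcongr
        nlinarith [norm_nonneg z, norm_nonneg w]
      _ = 2 := by norm_num
  have h2 : (1 - ‖z‖ ^ 2) * (1 - ‖w‖ ^ 2) / 4 ≤ 1 - pseudoDist z w ^ 2 := by
    rw [one_sub_pseudoDist_sq hz hw]
    gcongr
    nlinarith
  have h3 : 1 - pseudoDist z w ^ 2 ≤ 2 * (1 - pseudoDist z w) := by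
    nlinarith [pseudoDist_lt_one hz hw, pseudoDist_nonneg z w]
  have h4 : 1 - ‖w‖ ≤ 1 - ‖w‖ ^ 2 := by nlinarith [norm_nonneg w]
  rw [div_mul_eq_mul_div, le_div_iff₀ hz']
  nlinarith

/-- Replaces the triangle inequality: if `z` stays within a fixed distance of `a` and `w` is very
far from `a`, then `w` is far from `z`. It is the estimate of `one_sub_pseudoDist_sq_le` with the
origin moved to `a`, the identity `hid` expressing the Möbius invariance. -/
theorem one_sub_pseudoDist_sq_le_mul {z w a : ℂ} (hz : ‖z‖ < 1) (hw : ‖w‖ < 1) (ha : ‖a‖ < 1) :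
    1 - pseudoDist z w ^ 2 ≤
      (1 - pseudoDist w a ^ 2) * (2 / (1 - pseudoDist z a)) := by
  have hid : (1 - a * (starRingEnd ℂ) z) * (1 - (starRingEnd ℂ) a * w)
      - (starRingEnd ℂ) (z - a) * (w - a)
      = (1 - (starRingEnd ℂ) a * a) * (1 - (starRingEnd ℂ) z * w) := by
    simp only [map_sub]; ring
  have hA : ‖1 - a * (starRingEnd ℂ) z‖ = ‖1 - (starRingEnd ℂ) a * z‖ := by
    rw [← RCLike.norm_conj]; simp
  have haa : ‖1 - (starRingEnd ℂ) a * a‖ = 1 - ‖a‖ ^ 2 := by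
    rw [← Complex.normSq_eq_conj_mul_self, Complex.normSq_eq_norm_sq, ← Complex.ofReal_one,
      ← Complex.ofReal_sub, Complex.norm_real, Real.norm_of_nonneg (one_sub_norm_sq_pos ha).le]
  have pz := norm_pos_iff.2 (one_sub_conj_mul_ne_zero ha hz)
  have pw := norm_pos_iff.2 (one_sub_conj_mul_ne_zero ha hw)
  have pzw := norm_pos_iff.2 (one_sub_conj_mul_ne_zero hz hw)
  have nza : ‖z - a‖ = pseudoDist z a * ‖1 - (starRingEnd ℂ) a * z‖ := by
    rw [pseudoDist, norm_div, div_mul_cancel₀ _ pz.ne']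
  have nwa : ‖w - a‖ ≤ ‖1 - (starRingEnd ℂ) a * w‖ := by
    have := (pseudoDist_lt_one hw ha).le
    rwa [pseudoDist, norm_div, div_le_one pw] at this
  have hρ := pseudoDist_lt_one hz ha
  have hρ0 := pseudoDist_nonneg z a
  have key : ‖1 - (starRingEnd ℂ) a * z‖ * ‖1 - (starRingEnd ℂ) a * w‖ * (1 - pseudoDist z a)
      ≤ (1 - ‖a‖ ^ 2) * ‖1 - (starRingEnd ℂ) z * w‖ := by
    have h1 := norm_sub_norm_le ((1 - a * (starRingEnd ℂ) z) * (1 - (starRingEnd ℂ) a * w))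
      ((starRingEnd ℂ) (z - a) * (w - a))
    rw [hid, norm_mul, norm_mul, norm_mul, hA, haa, RCLike.norm_conj, nza] at h1
    have : pseudoDist z a * ‖1 - (starRingEnd ℂ) a * z‖ * ‖w - a‖
        ≤ pseudoDist z a * ‖1 - (starRingEnd ℂ) a * z‖ * ‖1 - (starRingEnd ℂ) a * w‖ := by gcongr
    linarith
  have hz' := one_sub_norm_sq_pos hz
  have hw' := one_sub_norm_sq_pos hw
  have ha' := one_sub_norm_sq_pos ha
  have hza : (1 - ‖z‖ ^ 2) * (1 - ‖a‖ ^ 2) =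
      (1 - pseudoDist z a ^ 2) * ‖1 - (starRingEnd ℂ) a * z‖ ^ 2 := by
    rw [one_sub_pseudoDist_sq hz ha, div_mul_cancel₀ _ (by positivity)]
  have hwa : (1 - ‖w‖ ^ 2) * (1 - ‖a‖ ^ 2) =
      (1 - pseudoDist w a ^ 2) * ‖1 - (starRingEnd ℂ) a * w‖ ^ 2 := by
    rw [one_sub_pseudoDist_sq hw ha, div_mul_cancel₀ _ (by positivity)]
  have hwa0 : 0 ≤ 1 - pseudoDist w a ^ 2 := by
    nlinarith [pseudoDist_lt_one hw ha, pseudoDist_nonneg w a]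
  have hza0 : 0 ≤ 1 - pseudoDist z a ^ 2 := by nlinarith
  have hρ' : 0 < 1 - pseudoDist z a := by linarith
  rw [one_sub_pseudoDist_sq hz hw, norm_one_sub_conj_mul_comm, div_le_iff₀ (by positivity)]
  have hsq : (‖1 - (starRingEnd ℂ) a * z‖ * ‖1 - (starRingEnd ℂ) a * w‖ *
      (1 - pseudoDist z a)) ^ 2 ≤ ((1 - ‖a‖ ^ 2) * ‖1 - (starRingEnd ℂ) z * w‖) ^ 2 := by gcongr
  refine le_of_mul_le_mul_left ?_ (pow_pos ha' 2)
  calc (1 - ‖a‖ ^ 2) ^ 2 * ((1 - ‖z‖ ^ 2) * (1 - ‖w‖ ^ 2))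
      = (1 - pseudoDist w a ^ 2) * ((1 - pseudoDist z a ^ 2) / (1 - pseudoDist z a) ^ 2) *
        (‖1 - (starRingEnd ℂ) a * z‖ * ‖1 - (starRingEnd ℂ) a * w‖ *
          (1 - pseudoDist z a)) ^ 2 := by
        rw [show (1 - ‖a‖ ^ 2) ^ 2 * ((1 - ‖z‖ ^ 2) * (1 - ‖w‖ ^ 2))
          = ((1 - ‖z‖ ^ 2) * (1 - ‖a‖ ^ 2)) * ((1 - ‖w‖ ^ 2) * (1 - ‖a‖ ^ 2)) by ring, hza, hwa]
        field_simp
    _ ≤ (1 - pseudoDist w a ^ 2) * (2 / (1 - pseudoDist z a)) *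
        ((1 - ‖a‖ ^ 2) * ‖1 - (starRingEnd ℂ) z * w‖) ^ 2 := by
        gcongr ?_ * ?_ * ?_
        · rw [div_le_div_iff₀ (by positivity) hρ']
          nlinarith [pow_pos hρ' 2, pow_pos hρ' 3]
    _ = _ := by ring

/-! ### The involutive automorphisms of the disc -/

/-- The involutive automorphism of the disc that exchanges `0` and `a`. -/
noncomputable def discInvolution (a z : ℂ) : ℂ := (a - z) / (1 - (starRingEnd ℂ) a * z)

theorem norm_discInvolution (a z : ℂ) : ‖discInvolution a z‖ = pseudoDist z a := by
  rw [discInvolution, pseudoDist, norm_div, norm_div, norm_sub_rev]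

theorem norm_discInvolution_lt_one {a z : ℂ} (ha : ‖a‖ < 1) (hz : ‖z‖ < 1) :
    ‖discInvolution a z‖ < 1 := by
  rw [norm_discInvolution]; exact pseudoDist_lt_one hz ha

theorem discInvolution_zero (a : ℂ) : discInvolution a 0 = a := by simp [discInvolution]

theorem discInvolution_discInvolution {a z : ℂ} (ha : ‖a‖ < 1) (hz : ‖z‖ < 1) :
    discInvolution a (discInvolution a z) = z := by
  have h1 := one_sub_conj_mul_ne_zero ha hz
  have h2 := one_sub_conj_mul_ne_zero ha (norm_discInvolution_lt_one ha hz)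
  have h3 : discInvolution a z * (1 - (starRingEnd ℂ) a * z) = a - z := div_mul_cancel₀ _ h1
  rw [discInvolution, div_eq_iff h2]
  linear_combination -h3

theorem pseudoDist_discInvolution {a z : ℂ} (ha : ‖a‖ < 1) (hz : ‖z‖ < 1) :
    pseudoDist (discInvolution a z) a = ‖z‖ := by
  rw [← norm_discInvolution, discInvolution_discInvolution ha hz]

theorem differentiableOn_discInvolution {a : ℂ} (ha : ‖a‖ < 1) :
    DifferentiableOn ℂ (discInvolution a) (ball 0 1) := by
  intro z hz
  have h := one_sub_conj_mul_ne_zero ha (mem_ball_zero_iff.1 hz)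
  exact (DifferentiableAt.div (differentiableAt_id.const_sub a)
    ((differentiableAt_id.const_mul _).const_sub 1) h).differentiableWithinAt

theorem mapsTo_discInvolution {a : ℂ} (ha : ‖a‖ < 1) :
    MapsTo (discInvolution a) (ball 0 1) (ball 0 1) := fun _ hz =>
  mem_ball_zero_iff.2 (norm_discInvolution_lt_one ha (mem_ball_zero_iff.1 hz))

/-! ### The Schwarz–Pick lemma -/

theorem norm_le_pseudoDist_of_eq_zero {F : ℂ → ℂ} (hF : DifferentiableOn ℂ F (ball 0 1))
    (hb : ∀ z ∈ ball (0 : ℂ) 1, ‖F z‖ ≤ 1) {a z : ℂ} (ha : ‖a‖ < 1) (hz : ‖z‖ < 1)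
    (h0 : F a = 0) : ‖F z‖ ≤ pseudoDist z a := by
  have hm := mapsTo_discInvolution ha
  have := Complex.norm_le_norm_of_mapsTo_ball (f := F ∘ discInvolution a) (R := 1)
    (z := discInvolution a z)
    (hF.comp (differentiableOn_discInvolution ha) hm)
    (fun w hw => mem_closedBall_zero_iff.2 (hb _ (hm hw)))
    (by simp [discInvolution_zero, h0]) (norm_discInvolution_lt_one ha hz)
  rwa [Function.comp_apply, discInvolution_discInvolution ha hz, norm_discInvolution] at this

theorem schwarz_pick_of_norm_lt {F : ℂ → ℂ} (hF : DifferentiableOn ℂ F (ball 0 1))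
    (hb : ∀ z ∈ ball (0 : ℂ) 1, ‖F z‖ < 1) {z w : ℂ} (hz : ‖z‖ < 1) (hw : ‖w‖ < 1) :
    ‖1 - (starRingEnd ℂ) (F w) * F z‖ ^ 2 * (1 - pseudoDist z w ^ 2) ≤
      (1 - ‖F z‖ ^ 2) * (1 - ‖F w‖ ^ 2) := by
  have bz := hb z (mem_ball_zero_iff.2 hz)
  have bw := hb w (mem_ball_zero_iff.2 hw)
  have h := norm_le_pseudoDist_of_eq_zero (F := discInvolution (F w) ∘ F) (a := w) (z := z)
    ((differentiableOn_discInvolution bw).comp hF fun x hx => mem_ball_zero_iff.2 (hb x hx))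
    (fun x hx => (norm_discInvolution_lt_one bw (hb x hx)).le) hw hz (by simp [discInvolution])
  rw [Function.comp_apply, norm_discInvolution] at h
  have h2 : 1 - pseudoDist z w ^ 2 ≤ 1 - pseudoDist (F z) (F w) ^ 2 := by
    have := pseudoDist_nonneg (F z) (F w)
    gcongr
  have hpos := norm_pos_iff.2 (one_sub_conj_mul_ne_zero bw bz)
  rw [one_sub_pseudoDist_sq bz bw, le_div_iff₀ (by positivity)] at h2
  linarith

/-- Without denominators the inequality still makes sense when `|F| = 1`, where it forces `F` to be
constant. The non-strict case follows from the strict one applied to `t F` as `t → 1⁻`. -/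
theorem schwarz_pick {F : ℂ → ℂ} (hF : DifferentiableOn ℂ F (ball 0 1))
    (hb : ∀ z ∈ ball (0 : ℂ) 1, ‖F z‖ ≤ 1) {z w : ℂ} (hz : ‖z‖ < 1) (hw : ‖w‖ < 1) :
    ‖1 - (starRingEnd ℂ) (F w) * F z‖ ^ 2 * (1 - pseudoDist z w ^ 2) ≤
      (1 - ‖F z‖ ^ 2) * (1 - ‖F w‖ ^ 2) := by
  have hev : ∀ᶠ t : ℝ in 𝓝[<] 1,
      ‖1 - (starRingEnd ℂ) (t * F w) * (t * F z)‖ ^ 2 * (1 - pseudoDist z w ^ 2) ≤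
      (1 - ‖t * F z‖ ^ 2) * (1 - ‖t * F w‖ ^ 2) := by
    filter_upwards [Ioo_mem_nhdsLT (zero_lt_one' ℝ)] with t ht
    refine schwarz_pick_of_norm_lt (F := fun x => t * F x) (hF.const_mul _) (fun x hx => ?_) hz hw
    rw [norm_mul, Complex.norm_real, Real.norm_of_nonneg ht.1.le]
    nlinarith [hb x hx, ht.1, ht.2, norm_nonneg (F x)]
  have hl : Tendsto (fun t : ℝ => ‖1 - (starRingEnd ℂ) (t * F w) * (t * F z)‖ ^ 2 *
      (1 - pseudoDist z w ^ 2)) (𝓝[<] 1)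
      (𝓝 (‖1 - (starRingEnd ℂ) ((1 : ℝ) * F w) * ((1 : ℝ) * F z)‖ ^ 2 *
      (1 - pseudoDist z w ^ 2))) := by
    refine (Continuous.tendsto ?_ 1).mono_left nhdsWithin_le_nhds
    simp only [map_mul, Complex.conj_ofReal]
    fun_prop
  have hr : Tendsto (fun t : ℝ => (1 - ‖t * F z‖ ^ 2) * (1 - ‖t * F w‖ ^ 2)) (𝓝[<] 1)
      (𝓝 ((1 - ‖(1 : ℝ) * F z‖ ^ 2) * (1 - ‖(1 : ℝ) * F w‖ ^ 2))) :=
    (Continuous.tendsto (by fun_prop) 1).mono_left nhdsWithin_le_nhds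
  simpa using le_of_tendsto_of_tendsto hl hr hev

/-! ### Minimum modulus principle -/

/-- The maximum principle for `1 / W`. -/
theorem le_norm_of_le_norm_sphere {W : ℂ → ℂ} (hW : DifferentiableOn ℂ W (ball 0 1)) {r c : ℝ}
    (hr : 0 < r) (hr1 : r < 1) (hc : 0 < c) (h0 : ∀ z, ‖z‖ ≤ r → W z ≠ 0)
    (hs : ∀ z, ‖z‖ = r → c ≤ ‖W z‖) {z : ℂ} (hz : ‖z‖ ≤ r) : c ≤ ‖W z‖ := by
  have hd : DifferentiableOn ℂ (fun w => (W w)⁻¹) (closedBall 0 r) :=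
    (hW.mono (closedBall_subset_ball hr1)).fun_inv fun w hw => h0 w (mem_closedBall_zero_iff.1 hw)
  have hd' : DiffContOnCl ℂ (fun w => (W w)⁻¹) (ball 0 r) :=
    DifferentiableOn.diffContOnCl (by rwa [closure_ball _ hr.ne'])
  have := Complex.norm_le_of_forall_mem_frontier_norm_le (C := c⁻¹) isBounded_ball hd'
    (fun w hw => by
      rw [frontier_ball _ hr.ne', mem_sphere_zero_iff_norm] at hw
      rw [norm_inv]
      exact inv_anti₀ hc (hs w hw))
    (z := z) (by rw [closure_ball _ hr.ne']; exact mem_closedBall_zero_iff.2 hz)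
  rw [norm_inv] at this
  exact (inv_le_inv₀ (norm_pos_iff.2 (h0 z hz)) hc).1 this

/-! ### Blaschke factors -/

theorem exists_blaschkeFactor_eq (a : ℂ) : ∃ κ : ℂ, ‖κ‖ = 1 ∧
    ∀ z, blaschkeFactor a z = κ * ((z - a) / (1 - (starRingEnd ℂ) a * z)) := by
  by_cases ha : a = 0
  · exact ⟨1, norm_one, fun z => by simp [blaschkeFactor, ha]⟩
  · refine ⟨-((starRingEnd ℂ) a / (‖a‖ : ℂ)), ?_, fun z => ?_⟩
    · rw [norm_neg, norm_div, RCLike.norm_conj, Complex.norm_real, norm_norm,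
        div_self (norm_ne_zero_iff.2 ha)]
    · rw [blaschkeFactor, if_neg ha, ← neg_sub z a]
      ring

theorem norm_blaschkeFactor (a z : ℂ) : ‖blaschkeFactor a z‖ = pseudoDist z a := by
  obtain ⟨κ, hκ, h⟩ := exists_blaschkeFactor_eq a
  rw [h, norm_mul, hκ, one_mul, pseudoDist]

theorem blaschkeFactor_self (a : ℂ) : blaschkeFactor a a = 0 := by
  rw [← norm_eq_zero, norm_blaschkeFactor, pseudoDist_self]

theorem blaschkeFactor_ne_zero {a z : ℂ} (ha : ‖a‖ < 1) (hz : ‖z‖ < 1) (h : z ≠ a) :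
    blaschkeFactor a z ≠ 0 := by
  rw [← norm_ne_zero_iff, norm_blaschkeFactor, pseudoDist, norm_ne_zero_iff]
  exact div_ne_zero (sub_ne_zero.2 h) (one_sub_conj_mul_ne_zero ha hz)

theorem differentiableOn_blaschkeFactor {a : ℂ} (ha : ‖a‖ < 1) :
    DifferentiableOn ℂ (blaschkeFactor a) (ball 0 1) := by
  obtain ⟨κ, hκ, h⟩ := exists_blaschkeFactor_eq a
  rw [funext h]
  intro z hz
  have h := one_sub_conj_mul_ne_zero ha (mem_ball_zero_iff.1 hz)
  exact (DifferentiableAt.const_mul (DifferentiableAt.fun_div (differentiableAt_id.sub_const a)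
    ((differentiableAt_id.const_mul _).const_sub 1) h) κ).differentiableWithinAt

theorem norm_deriv_blaschkeFactor_self {a : ℂ} (ha : ‖a‖ < 1) :
    ‖deriv (blaschkeFactor a) a‖ = (1 - ‖a‖ ^ 2)⁻¹ := by
  obtain ⟨κ, hκ, h⟩ := exists_blaschkeFactor_eq a
  have hne := one_sub_conj_mul_ne_zero ha ha
  have hd : HasDerivAt (fun z => κ * ((z - a) / (1 - (starRingEnd ℂ) a * z)))
      (κ * ((1 * (1 - (starRingEnd ℂ) a * a) - (a - a) * (-((starRingEnd ℂ) a * 1))) /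
        (1 - (starRingEnd ℂ) a * a) ^ 2)) a :=
    ((((hasDerivAt_id a).sub_const a).div (((hasDerivAt_id a).const_mul _).const_sub 1)
      hne).const_mul κ)
  have haa : ‖1 - (starRingEnd ℂ) a * a‖ = 1 - ‖a‖ ^ 2 := by
    rw [← Complex.normSq_eq_conj_mul_self, Complex.normSq_eq_norm_sq, ← Complex.ofReal_one,
      ← Complex.ofReal_sub, Complex.norm_real, Real.norm_of_nonneg (one_sub_norm_sq_pos ha).le]
  rw [funext h, hd.deriv, norm_mul, hκ, ← haa, sub_self, zero_mul, sub_zero, one_mul, one_mul,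
    norm_div, norm_pow, pow_two]
  have := norm_ne_zero_iff.2 hne
  field_simp

/-- The normalisation by `conj a / |a|` makes `1 - |a|` a factor of `1 - b_a`; this gives
convergence of the product under the Blaschke condition. -/
theorem norm_one_sub_blaschkeFactor_le {a z : ℂ} (ha : ‖a‖ < 1) (hz : ‖z‖ < 1) :
    ‖1 - blaschkeFactor a z‖ ≤ (1 - ‖a‖) * (2 / (1 - ‖z‖)) := by
  have hz' : 0 < 1 - ‖z‖ := by linarith
  have ha' : 0 < 1 - ‖a‖ := by linarith
  by_cases h0 : a = 0
  · subst h0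
    simp only [blaschkeFactor, if_true, norm_zero, sub_zero, one_mul]
    have h1 : ‖1 - z‖ ≤ 2 := by
      have := norm_sub_le (1 : ℂ) z
      rw [norm_one] at this
      linarith
    refine h1.trans ?_
    rw [le_div_iff₀ hz']
    nlinarith [norm_nonneg z]
  · have hna : (‖a‖ : ℂ) ≠ 0 := by simpa using h0
    have hna' : 0 < ‖a‖ := norm_pos_iff.2 h0
    have hne := one_sub_conj_mul_ne_zero ha hz
    have hsq : (starRingEnd ℂ) a * a = (‖a‖ : ℂ) ^ 2 := Complex.conj_mul' a
    have heq : 1 - blaschkeFactor a z =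
        ((1 - ‖a‖ : ℝ) : ℂ) * ((‖a‖ + (starRingEnd ℂ) a * z) /
          (‖a‖ * (1 - (starRingEnd ℂ) a * z))) := by
      rw [blaschkeFactor, if_neg h0]
      push_cast
      field_simp
      linear_combination -hsq
    rw [heq, norm_mul, Complex.norm_real, Real.norm_of_nonneg ha'.le]
    gcongr
    rw [norm_div, norm_mul, Complex.norm_real, norm_norm]
    have h1 : ‖(‖a‖ : ℂ) + (starRingEnd ℂ) a * z‖ ≤ ‖a‖ * 2 := by
      refine (norm_add_le _ _).trans ?_
      rw [norm_mul, RCLike.norm_conj, Complex.norm_real, norm_norm]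
      nlinarith
    have h2 := one_sub_norm_le_norm_one_sub_conj_mul (z := z) ha.le
    calc _ ≤ ‖a‖ * 2 / (‖a‖ * (1 - ‖z‖)) := by gcongr
      _ = 2 / (1 - ‖z‖) := by field_simp

theorem analyticAt_blaschkeFactor {a z : ℂ} (ha : ‖a‖ < 1) (hz : ‖z‖ < 1) :
    AnalyticAt ℂ (blaschkeFactor a) z :=
  (differentiableOn_blaschkeFactor ha).analyticAt (isOpen_ball.mem_nhds (mem_ball_zero_iff.2 hz))

open Classical in
theorem analyticOrderAt_blaschkeFactor {a z : ℂ} (ha : ‖a‖ < 1) (hz : ‖z‖ < 1) :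
    analyticOrderAt (blaschkeFactor a) z = if a = z then 1 else 0 := by
  split_ifs with h
  · subst h
    refine AnalyticAt.analyticOrderAt_eq_one_of_zero_deriv_ne_zero
      (analyticAt_blaschkeFactor ha ha) (blaschkeFactor_self a) ?_
    rw [← norm_ne_zero_iff, norm_deriv_blaschkeFactor_self ha]
    exact inv_ne_zero (one_sub_norm_sq_pos ha).ne'
  · rw [(analyticAt_blaschkeFactor ha hz).analyticOrderAt_eq_zero]
    exact blaschkeFactor_ne_zero ha hz (Ne.symm h)

open Classical in
theorem analyticOrderAt_of_eq_blaschkeFactor_mul {F Q : ℂ → ℂ} {a z : ℂ}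
    (hQ : DifferentiableOn ℂ Q (ball 0 1))
    (h : ∀ z ∈ ball (0 : ℂ) 1, F z = blaschkeFactor a z * Q z) (ha : ‖a‖ < 1) (hz : ‖z‖ < 1) :
    analyticOrderAt F z = (if a = z then 1 else 0) + analyticOrderAt Q z := by
  have hz' : ball (0 : ℂ) 1 ∈ 𝓝 z := isOpen_ball.mem_nhds (mem_ball_zero_iff.2 hz)
  have : F =ᶠ[𝓝 z] blaschkeFactor a * Q := by
    filter_upwards [hz'] with w hw using h w hw
  rw [analyticOrderAt_congr this, analyticOrderAt_mul (analyticAt_blaschkeFactor ha hz)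
    (hQ.analyticAt hz'), analyticOrderAt_blaschkeFactor ha hz]

/-- The singularity of `F / b_a` at `a` is removable. The Schwarz lemma bounds the quotient away
from `a`, and continuity at `a`. -/
theorem exists_eq_blaschkeFactor_mul {F : ℂ → ℂ} (hF : DifferentiableOn ℂ F (ball 0 1))
    (hb : ∀ z ∈ ball (0 : ℂ) 1, ‖F z‖ ≤ 1) {a : ℂ} (ha : ‖a‖ < 1) (h0 : F a = 0) :
    ∃ Q : ℂ → ℂ, DifferentiableOn ℂ Q (ball 0 1) ∧ (∀ z ∈ ball (0 : ℂ) 1, ‖Q z‖ ≤ 1) ∧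
      ∀ z ∈ ball (0 : ℂ) 1, F z = blaschkeFactor a z * Q z := by
  obtain ⟨κ, hκ, h⟩ := exists_blaschkeFactor_eq a
  have hκ0 : κ ≠ 0 := by rw [← norm_ne_zero_iff, hκ]; exact one_ne_zero
  have ha' : a ∈ ball (0 : ℂ) 1 := mem_ball_zero_iff.2 ha
  set Q : ℂ → ℂ := fun z => κ⁻¹ * (dslope F a z * (1 - (starRingEnd ℂ) a * z)) with hQ
  have hQd : DifferentiableOn ℂ Q (ball 0 1) := by
    refine DifferentiableOn.const_mul (DifferentiableOn.mul ?_ (by fun_prop)) _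
    exact (Complex.differentiableOn_dslope (isOpen_ball.mem_nhds ha')).2 hF
  have heq : ∀ z ∈ ball (0 : ℂ) 1, F z = blaschkeFactor a z * Q z := by
    intro z hz
    have hne := one_sub_conj_mul_ne_zero ha (mem_ball_zero_iff.1 hz)
    have hs : (z - a) * dslope F a z = F z := by
      have := sub_smul_dslope F a z
      rwa [h0, sub_zero, smul_eq_mul] at this
    simp only [h, hQ, ← hs]
    generalize 1 - (starRingEnd ℂ) a * z = d at hne
    field_simp
  refine ⟨Q, hQd, ?_, heq⟩
  have hoff : ∀ z ∈ ball (0 : ℂ) 1, z ≠ a → ‖Q z‖ ≤ 1 := by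
    intro z hz hza
    have hz' := mem_ball_zero_iff.1 hz
    have h1 := norm_le_pseudoDist_of_eq_zero hF hb ha hz' h0
    have h2 := norm_pos_iff.2 (blaschkeFactor_ne_zero ha hz' hza)
    rw [heq z hz, norm_mul, ← norm_blaschkeFactor] at h1
    exact le_of_mul_le_mul_left (by linarith) h2
  intro z hz
  by_cases hza : z = a
  · subst hza
    have hc : Tendsto (fun w => ‖Q w‖) (𝓝[≠] z) (𝓝 ‖Q z‖) :=
      ((hQd.continuousOn.continuousAt (isOpen_ball.mem_nhds hz)).norm.tendsto).mono_left
        nhdsWithin_le_nhds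
    refine le_of_tendsto hc ?_
    filter_upwards [self_mem_nhdsWithin, nhdsWithin_le_nhds (isOpen_ball.mem_nhds hz)] with w hw hw'
    exact hoff w hw' hw
  · exact hoff z hz hza

/-- A function bounded by one on the disc whose zeros are enumerated, with multiplicities, by the
restriction of `a` to `t` can be divided by any finite subproduct of the Blaschke factors. -/
theorem exists_eq_prod_blaschkeFactor_mul {ι : Type*} {a : ι → ℂ} (ha : ∀ k, ‖a k‖ < 1)
    (s : Finset ι) : ∀ (t : Set ι) (F : ℂ → ℂ), DifferentiableOn ℂ F (ball 0 1) →
    (∀ z ∈ ball (0 : ℂ) 1, ‖F z‖ ≤ 1) → ↑s ⊆ t →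
    (∀ z ∈ ball (0 : ℂ) 1, {k ∈ t | a k = z}.encard = analyticOrderAt F z) →
    ∃ Q : ℂ → ℂ, DifferentiableOn ℂ Q (ball 0 1) ∧ (∀ z ∈ ball (0 : ℂ) 1, ‖Q z‖ ≤ 1) ∧
      (∀ z ∈ ball (0 : ℂ) 1, {k ∈ t \ ↑s | a k = z}.encard = analyticOrderAt Q z) ∧
      ∀ z ∈ ball (0 : ℂ) 1, F z = (∏ k ∈ s, blaschkeFactor (a k) z) * Q z := by
  classical
  induction s using Finset.induction_on with
  | empty =>
    intro t F hF hb _ ho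
    exact ⟨F, hF, hb, by simpa using ho, by simp⟩
  | insert k s hk ih =>
    intro t F hF hb hst ho
    have hkt : k ∈ t := hst (by simp)
    have hkb : a k ∈ ball (0 : ℂ) 1 := mem_ball_zero_iff.2 (ha k)
    have hF0 : F (a k) = 0 := by
      by_contra hne
      have h1 := ho _ hkb
      rw [(hF.analyticAt (isOpen_ball.mem_nhds hkb)).analyticOrderAt_eq_zero.2 hne,
        Set.encard_eq_zero] at h1
      exact (h1 ▸ (⟨hkt, rfl⟩ : k ∈ {j ∈ t | a j = a k}) : k ∈ (∅ : Set ι))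
    obtain ⟨Q₁, hQ₁, hb₁, h₁⟩ := exists_eq_blaschkeFactor_mul hF hb (ha k) hF0
    have ho₁ : ∀ z ∈ ball (0 : ℂ) 1, {j ∈ t \ {k} | a j = z}.encard = analyticOrderAt Q₁ z := by
      intro z hz
      have h2 := ho z hz
      rw [analyticOrderAt_of_eq_blaschkeFactor_mul hQ₁ h₁ (ha k) (mem_ball_zero_iff.1 hz)] at h2
      split_ifs at h2 with h3
      · have h4 : {j ∈ t | a j = z} = insert k {j ∈ t \ {k} | a j = z} := by
          ext j
          by_cases hj : j = k
          · subst hj; simp [hkt, h3]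
          · simp [hj]
        rw [h4, Set.encard_insert_of_notMem (by simp), add_comm] at h2
        exact ENat.add_right_injective_of_ne_top ENat.one_ne_top h2
      · have h4 : {j ∈ t | a j = z} = {j ∈ t \ {k} | a j = z} := by
          ext j
          by_cases hj : j = k
          · subst hj; simp [h3]
          · simp [hj]
        rw [← h4, h2, zero_add]
    obtain ⟨Q, hQ, hbQ, hoQ, hQe⟩ := ih (t \ {k}) Q₁ hQ₁ hb₁ (fun j hj => ⟨hst (by
      simp only [Finset.coe_insert]; exact Or.inr hj), fun h => hk (by
      rw [mem_singleton_iff] at h; exact h ▸ hj)⟩) ho₁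
    refine ⟨Q, hQ, hbQ, fun z hz => ?_, fun z hz => ?_⟩
    · rw [← hoQ z hz, Finset.coe_insert, ← Set.singleton_union, ← Set.sdiff_sdiff]
    · rw [h₁ z hz, hQe z hz, Finset.prod_insert hk, mul_assoc]

/-! ### Bounded analytic functions with radial boundary values of modulus at most one -/

/-- Cauchy's formula for `F ^ n` on circles of radius `r → 1`, with dominated convergence. The
right-hand side does not depend on `n`, so `n → ∞` will give `|F| ≤ 1`. The maximum with `1` encodes
"upper radial limit at most one", so radial limits of `F` need not exist. -/
theorem norm_pow_le_of_radial {F : ℂ → ℂ} (hF : DifferentiableOn ℂ F (ball 0 1)) {C : ℝ}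
    (hb : ∀ z ∈ ball (0 : ℂ) 1, ‖F z‖ ≤ C)
    (hr : ∀ᵐ θ : ℝ, Tendsto (fun r : ℝ => max ‖F (r * Complex.exp (θ * Complex.I))‖ 1)
      (𝓝[<] 1) (𝓝 1)) {z : ℂ} (hz : ‖z‖ < 1) (n : ℕ) : ‖F z‖ ^ n ≤ (1 - ‖z‖)⁻¹ := by
  have hmem : ∀ r ∈ Ioo ‖z‖ 1, ∀ θ : ℝ, circleMap 0 r θ ∈ ball (0 : ℂ) 1 := by
    intro r hr θ
    rw [mem_ball_zero_iff, norm_circleMap_zero, abs_of_pos ((norm_nonneg z).trans_lt hr.1)]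
    exact hr.2
  have hcont : ∀ r ∈ Ioo ‖z‖ 1, Continuous fun θ : ℝ => max ‖F (circleMap 0 r θ)‖ 1 ^ n := by
    intro r hr
    have : Continuous fun θ : ℝ => F (circleMap 0 r θ) :=
      hF.continuousOn.comp_continuous (continuous_circleMap 0 r) (hmem r hr)
    exact (this.norm.max continuous_const).pow n
  have hIoo : Ioo ‖z‖ 1 ∈ 𝓝[<] (1 : ℝ) := Ioo_mem_nhdsLT hz
  have hlim : Tendsto (fun r : ℝ => ∫ θ in (0 : ℝ)..2 * Real.pi, max ‖F (circleMap 0 r θ)‖ 1 ^ n)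
      (𝓝[<] 1) (𝓝 (∫ _ in (0 : ℝ)..2 * Real.pi, (1 : ℝ) ^ n)) := by
    refine intervalIntegral.tendsto_integral_filter_of_dominated_convergence
      (fun _ => max C 1 ^ n) ?_ ?_ intervalIntegrable_const ?_
    · filter_upwards [hIoo] with r hr using (hcont r hr).aestronglyMeasurable
    · filter_upwards [hIoo] with r hr
      refine Eventually.of_forall fun θ _ => ?_
      rw [Real.norm_of_nonneg (by positivity)]
      gcongr
      exact hb _ (hmem r hr θ)
    · filter_upwards [hr] with θ hθ _
      simpa [circleMap] using hθ.pow n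
  have hle : ∀ᶠ r in 𝓝[<] (1 : ℝ), 2 * Real.pi * ‖F z‖ ^ n ≤ r * (r - ‖z‖)⁻¹ *
      ∫ θ in (0 : ℝ)..2 * Real.pi, max ‖F (circleMap 0 r θ)‖ 1 ^ n := by
    filter_upwards [hIoo] with r hr
    have hr0 : 0 < r := (norm_nonneg z).trans_lt hr.1
    have hrz : 0 < r - ‖z‖ := sub_pos.2 hr.1
    have hc := DifferentiableOn.circleIntegral_sub_inv_smul (f := fun w => F w ^ n) (c := 0)
      (R := r) (w := z) ((hF.mono (closedBall_subset_ball hr.2)).pow n)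
      (mem_ball_zero_iff.2 hr.1)
    have h1 : ‖(2 * Real.pi * Complex.I : ℂ) • F z ^ n‖ = 2 * Real.pi * ‖F z‖ ^ n := by
      simp [abs_of_pos Real.pi_pos]
    rw [← h1, ← hc, circleIntegral, ← intervalIntegral.integral_const_mul]
    refine intervalIntegral.norm_integral_le_of_norm_le (by positivity)
      (Eventually.of_forall fun θ _ => ?_) ((hcont r hr).const_mul _ |>.intervalIntegrable _ _)
    have h2 : r - ‖z‖ ≤ ‖circleMap 0 r θ - z‖ := by
      have := norm_sub_norm_le (circleMap 0 r θ) z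
      rwa [norm_circleMap_zero, abs_of_pos hr0] at this
    rw [norm_smul, norm_smul, norm_inv, norm_pow, deriv_circleMap, norm_mul, norm_circleMap_zero,
      abs_of_pos hr0, Complex.norm_I, mul_one, mul_assoc]
    gcongr
    exact le_max_left _ _
  have hlim2 : Tendsto (fun r : ℝ => r * (r - ‖z‖)⁻¹ *
      ∫ θ in (0 : ℝ)..2 * Real.pi, max ‖F (circleMap 0 r θ)‖ 1 ^ n)
      (𝓝[<] 1) (𝓝 (1 * (1 - ‖z‖)⁻¹ * ∫ _ in (0 : ℝ)..2 * Real.pi, (1 : ℝ) ^ n)) := by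
    have hid : Tendsto (fun r : ℝ => r) (𝓝[<] 1) (𝓝 1) := nhdsWithin_le_nhds
    exact (hid.mul ((hid.sub_const ‖z‖).inv₀ (by linarith))).mul hlim
  have hfin := ge_of_tendsto hlim2 hle
  simp only [one_pow, intervalIntegral.integral_const, sub_zero, smul_eq_mul, mul_one,
    one_mul] at hfin
  have hpi := Real.pi_pos
  refine le_of_mul_le_mul_left (a := 2 * Real.pi) ?_ (by positivity)
  linarith

theorem norm_le_one_of_radial {F : ℂ → ℂ} (hF : DifferentiableOn ℂ F (ball 0 1)) {C : ℝ}
    (hb : ∀ z ∈ ball (0 : ℂ) 1, ‖F z‖ ≤ C)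
    (hr : ∀ᵐ θ : ℝ, Tendsto (fun r : ℝ => max ‖F (r * Complex.exp (θ * Complex.I))‖ 1)
      (𝓝[<] 1) (𝓝 1)) : ∀ z ∈ ball (0 : ℂ) 1, ‖F z‖ ≤ 1 := by
  intro z hz
  by_contra! hlt
  obtain ⟨n, hn⟩ := pow_unbounded_of_one_lt (1 - ‖z‖)⁻¹ hlt
  exact hn.not_ge (norm_pow_le_of_radial hF hb hr (mem_ball_zero_iff.1 hz) n)

/-! ### The algebra `H^∞` -/

namespace HInf

theorem differentiableOn_eval (f : HInf) : DifferentiableOn ℂ (HInf.eval f) (ball 0 1) := f.2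

theorem norm_eval_le (f : HInf) {z : ℂ} (hz : z ∈ ball (0 : ℂ) 1) : ‖HInf.eval f z‖ ≤ ‖f‖ := by
  rw [eval, discExt_apply _ hz]
  exact (f : Disc →ᵇ ℂ).norm_coe_le_norm _

theorem eval_mul (f g : HInf) {z : ℂ} (hz : z ∈ ball (0 : ℂ) 1) :
    HInf.eval (f * g) z = HInf.eval f z * HInf.eval g z := by
  simp [eval, discExt_apply _ hz]

theorem eval_sub (f g : HInf) {z : ℂ} (hz : z ∈ ball (0 : ℂ) 1) :
    HInf.eval (f - g) z = HInf.eval f z - HInf.eval g z := by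
  simp [eval, discExt_apply _ hz]

theorem eval_one {z : ℂ} (hz : z ∈ ball (0 : ℂ) 1) : HInf.eval (1 : HInf) z = 1 := by
  simp [eval, discExt_apply _ hz]

theorem exists_eval_eq {F : ℂ → ℂ} (hF : DifferentiableOn ℂ F (ball 0 1)) {C : ℝ}
    (hC : 0 ≤ C) (hb : ∀ z ∈ ball (0 : ℂ) 1, ‖F z‖ ≤ C) :
    ∃ f : HInf, ‖f‖ ≤ C ∧ ∀ z ∈ ball (0 : ℂ) 1, HInf.eval f z = F z := by
  have hc : Continuous fun z : Disc => F z := hF.continuousOn.domRestrict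
  let f₀ : Disc →ᵇ ℂ := BoundedContinuousFunction.ofNormedAddCommGroup (fun z : Disc => F z) hc C
    fun z => hb z z.2
  have hev : ∀ z ∈ ball (0 : ℂ) 1, discExt f₀ z = F z := fun z hz => discExt_apply _ hz
  exact ⟨⟨f₀, hF.congr hev⟩, BoundedContinuousFunction.norm_ofNormedAddCommGroup_le hc hC fun z => hb z z.2, hev⟩

end HInf

/-! ### Inner functions -/

theorem mul_exp_mem_ball {r : ℝ} (hr : r ∈ Ioo (0 : ℝ) 1) (θ : ℝ) :
    (r : ℂ) * Complex.exp (θ * Complex.I) ∈ ball (0 : ℂ) 1 := by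
  rw [mem_ball_zero_iff, norm_mul, Complex.norm_exp_ofReal_mul_I, mul_one, Complex.norm_real,
    Real.norm_of_nonneg hr.1.le]
  exact hr.2

namespace IsInner

variable {Θ : HInf}

theorem ae_tendsto_norm (hΘ : IsInner Θ) : ∀ᵐ θ : ℝ,
    Tendsto (fun r : ℝ => ‖HInf.eval Θ (r * Complex.exp (θ * Complex.I))‖) (𝓝[<] 1) (𝓝 1) := by
  filter_upwards [hΘ] with θ ⟨ζ, h1, h⟩
  simpa [h1] using h.norm

theorem norm_eval_le_one (hΘ : IsInner Θ) : ∀ z ∈ ball (0 : ℂ) 1, ‖HInf.eval Θ z‖ ≤ 1 := by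
  refine norm_le_one_of_radial (HInf.differentiableOn_eval Θ) (fun z hz => HInf.norm_eval_le Θ hz) ?_
  filter_upwards [hΘ.ae_tendsto_norm] with θ h
  simpa using h.max (tendsto_const_nhds (x := (1 : ℝ)))

/-- Division by an inner function does not increase the norm. -/
theorem norm_le_one_of_norm_mul_le_one (hΘ : IsInner Θ) {F : ℂ → ℂ}
    (hF : DifferentiableOn ℂ F (ball 0 1)) {C : ℝ} (hb : ∀ z ∈ ball (0 : ℂ) 1, ‖F z‖ ≤ C)
    (h : ∀ z ∈ ball (0 : ℂ) 1, ‖F z * HInf.eval Θ z‖ ≤ 1) : ∀ z ∈ ball (0 : ℂ) 1, ‖F z‖ ≤ 1 := by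
  refine norm_le_one_of_radial hF hb ?_
  filter_upwards [hΘ.ae_tendsto_norm] with θ hθ
  have hu : Tendsto (fun r : ℝ => max ‖HInf.eval Θ (r * Complex.exp (θ * Complex.I))‖⁻¹ 1)
      (𝓝[<] 1) (𝓝 1) := by
    -- Where `|F Θ| ≤ 1` and `Θ ≠ 0` one has `|F| ≤ 1 / |Θ|`, and this majorant tends to `1`
    -- radially.
    simpa using (hθ.inv₀ one_ne_zero).max (tendsto_const_nhds (x := (1 : ℝ)))
  refine tendsto_of_tendsto_of_tendsto_of_le_of_le' tendsto_const_nhds hu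
    (Eventually.of_forall fun r => le_max_right _ _) ?_
  filter_upwards [Ioo_mem_nhdsLT (zero_lt_one' ℝ), hθ.eventually_const_lt zero_lt_one]
    with r hr hpos
  gcongr
  rw [← one_div, le_div_iff₀ hpos, ← norm_mul]
  exact h _ (mul_exp_mem_ball hr θ)

theorem exists_eval_ne_zero (hΘ : IsInner Θ) : ∃ z ∈ ball (0 : ℂ) 1, HInf.eval Θ z ≠ 0 := by
  obtain ⟨θ, hθ⟩ := hΘ.ae_tendsto_norm.exists
  obtain ⟨r, hr, hpos⟩ := (Eventually.and (Ioo_mem_nhdsLT (zero_lt_one' ℝ))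
    (hθ.eventually_const_lt zero_lt_one)).exists
  exact ⟨_, mul_exp_mem_ball hr θ, norm_pos_iff.1 hpos⟩

end IsInner

/-! ### Lower bounds for inner functions with the sharp invertibility property -/

/-- The map `w ↦ M (w - 1) / (M² - w)` is bounded by `1` on `|w| ≤ M`: the difference of the squares
of the two sides is `(M² - 1)(M² - |G|²)`. -/
theorem norm_sub_mul_le_norm_sub {G : ℂ} {M : ℝ} (hM : 1 ≤ M) (hG : ‖G‖ ≤ M) :
    M * ‖G - 1‖ ≤ ‖(M : ℂ) ^ 2 - G‖ := by
  have hG2 : ‖G‖ ^ 2 ≤ M ^ 2 := by gcongr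
  refine (sq_le_sq₀ (by positivity) (by positivity)).1 ?_
  rw [mul_pow]
  simp only [← Complex.ofReal_pow, Complex.sq_norm, Complex.normSq_apply, Complex.sub_re,
    Complex.sub_im, Complex.one_re, Complex.one_im, Complex.ofReal_re, Complex.ofReal_im] at hG2 ⊢
  nlinarith [mul_nonneg (sub_nonneg.2 hG2) (show 0 ≤ M ^ 2 - 1 by nlinarith)]

theorem one_div_le_norm_eval {Θ : HInf} (hΘ : IsInner Θ) {h g : HInf} {M : ℝ} (hM : 1 < M)
    (hh : ‖h‖ ≤ M) {z₀ : ℂ} (hz₀ : ‖z₀‖ < 1)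
    (heq : ∀ z ∈ ball (0 : ℂ) 1, blaschkeFactor z₀ z * HInf.eval h z = 1 + HInf.eval g z * HInf.eval Θ z) :
    1 / M ≤ ‖HInf.eval Θ z₀‖ := by
  have hM0 : 0 < M := by linarith
  set G : ℂ → ℂ := fun z => 1 + HInf.eval g z * HInf.eval Θ z with hGdef
  have hGz : ∀ z ∈ ball (0 : ℂ) 1, G z = blaschkeFactor z₀ z * HInf.eval h z := fun z hz =>
    (heq z hz).symm
  have hGb : ∀ z ∈ ball (0 : ℂ) 1, ‖G z‖ ≤ M := by
    intro z hz
    rw [hGz z hz, norm_mul, norm_blaschkeFactor]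
    have h1 := (pseudoDist_lt_one (mem_ball_zero_iff.1 hz) hz₀).le
    have h2 := (HInf.norm_eval_le h hz).trans hh
    calc _ ≤ 1 * M := by gcongr
      _ = M := one_mul M
  have hGd : DifferentiableOn ℂ G (ball 0 1) :=
    ((HInf.differentiableOn_eval g).fun_mul (HInf.differentiableOn_eval Θ)).const_add 1
  have hden : ∀ z ∈ ball (0 : ℂ) 1, M ^ 2 - M ≤ ‖(M : ℂ) ^ 2 - G z‖ := by
    intro z hz
    have h1 := norm_sub_norm_le ((M : ℂ) ^ 2) (G z)
    rw [norm_pow, Complex.norm_real, Real.norm_of_nonneg hM0.le] at h1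
    linarith [hGb z hz]
  have hMM : 0 < M ^ 2 - M := by nlinarith
  have hpos : ∀ z ∈ ball (0 : ℂ) 1, 0 < ‖(M : ℂ) ^ 2 - G z‖ := fun z hz =>
    hMM.trans_le (hden z hz)
  -- The Möbius image of `G`, with the factor `Θ` of `G - 1` removed. Strictness of `1 < M` keeps
  -- the denominator away from zero. At `z₀`, where `G = 0`, the bound reads `|g(z₀)| ≤ M`.
  have hq := hΘ.norm_le_one_of_norm_mul_le_one
    (F := fun z => M * HInf.eval g z / ((M : ℂ) ^ 2 - G z)) (C := M * ‖g‖ / (M ^ 2 - M))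
    (((HInf.differentiableOn_eval g).const_mul _).fun_div (hGd.const_sub _)
      fun z hz => norm_pos_iff.1 (hpos z hz))
    (fun z hz => by
      rw [norm_div, norm_mul, Complex.norm_real, Real.norm_of_nonneg hM0.le]
      gcongr
      · exact HInf.norm_eval_le g hz
      · exact hden z hz)
    (fun z hz => by
      rw [div_mul_eq_mul_div, norm_div, mul_assoc, norm_mul, Complex.norm_real,
        Real.norm_of_nonneg hM0.le, div_le_one (hpos z hz)]
      have h1 : HInf.eval g z * HInf.eval Θ z = G z - 1 := by simp [hGdef]
      rw [h1]
      exact norm_sub_mul_le_norm_sub hM.le (hGb z hz))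
    z₀ (mem_ball_zero_iff.2 hz₀)
  have hG0 : G z₀ = 0 := by
    rw [hGz z₀ (mem_ball_zero_iff.2 hz₀), blaschkeFactor_self, zero_mul]
  have hgΘ : ‖HInf.eval g z₀‖ * ‖HInf.eval Θ z₀‖ = 1 := by
    have h1 : HInf.eval g z₀ * HInf.eval Θ z₀ = -1 := eq_neg_of_add_eq_zero_right hG0
    rw [← norm_mul, h1, norm_neg, norm_one]
  rw [hG0, sub_zero, norm_div, norm_mul, norm_pow, Complex.norm_real, Real.norm_of_nonneg hM0.le,
    div_le_one (by positivity)] at hq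
  have hgM : ‖HInf.eval g z₀‖ ≤ M := by nlinarith
  rw [div_le_iff₀ hM0, ← hgΘ, mul_comm]
  gcongr

theorem SharpInvertibility.exists_le_norm_eval {Θ : HInf} (hΘ : IsInner Θ)
    (hS : SharpInvertibility Θ) {ε : ℝ} (hε : 0 < ε) : ∃ δ : ℝ, 0 < δ ∧ ∀ z₀ : ℂ, ‖z₀‖ < 1 →
      (∀ ζ ∈ zeroSet Θ, 1 - δ ≤ pseudoDist z₀ ζ) → 1 - ε ≤ ‖HInf.eval Θ z₀‖ := by
  -- Half of `ε` goes to the SIP, half to lifting the inverse class to a function, as the quotient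
  -- norm need not be attained.
  obtain ⟨δ, hδ, H⟩ := hS (ε / 2) (by positivity)
  refine ⟨δ, hδ, fun z₀ hz₀ hζ => ?_⟩
  obtain ⟨f, hf1, hf⟩ := HInf.exists_eval_eq (differentiableOn_blaschkeFactor hz₀) zero_le_one
    fun z hz => by
      rw [norm_blaschkeFactor]; exact (pseudoDist_lt_one (mem_ball_zero_iff.1 hz) hz₀).le
  obtain ⟨u, hu, hu'⟩ := H f ((Ideal.Quotient.norm_mk_le (I := Ideal.span {Θ}) f).trans hf1)
    fun ζ hz => by
      rw [hf ζ hz.1, norm_blaschkeFactor, pseudoDist_comm]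
      exact hζ ζ hz
  obtain ⟨h, hh, hhn⟩ := Ideal.Quotient.norm_mk_lt (I := Ideal.span {Θ})
    (((u⁻¹ : (QuotAlg Θ)ˣ) : QuotAlg Θ)) (ε := ε / 2) (by positivity)
  have h1 : quotClass Θ (f * h) = quotClass Θ 1 := by
    rw [map_mul, map_one, ← hu, ← u.mul_inv]
    exact congrArg _ hh
  obtain ⟨g, hg⟩ := Ideal.mem_span_singleton'.1 (Ideal.Quotient.eq.1 h1)
  have hM : ‖h‖ ≤ 1 + ε := by
    have : ‖h‖ < ‖((u⁻¹ : (QuotAlg Θ)ˣ) : QuotAlg Θ)‖ + ε / 2 := hhn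
    linarith
  have h2 := one_div_le_norm_eval hΘ (h := h) (g := g) (M := 1 + ε) (by linarith) hM hz₀
    fun z hz => by
      have h3 := congrArg (fun φ : HInf => HInf.eval φ z) hg
      simp only [HInf.eval_mul _ _ hz, HInf.eval_sub _ _ hz, HInf.eval_one hz, hf z hz] at h3
      rw [h3]; ring
  refine le_trans ?_ h2
  rw [le_div_iff₀ (by linarith)]
  nlinarith

/-! ### Zero sequences -/

section ZeroSequence

variable {ι : Type*} {α : ι → ℂ}

theorem norm_le_norm_prod_blaschkeFactor (hα : ∀ k, ‖α k‖ < 1) {F : ℂ → ℂ}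
    (hF : DifferentiableOn ℂ F (ball 0 1)) (hb : ∀ z ∈ ball (0 : ℂ) 1, ‖F z‖ ≤ 1)
    (ho : ∀ z ∈ ball (0 : ℂ) 1, {k | α k = z}.encard = analyticOrderAt F z) (s : Finset ι)
    {z : ℂ} (hz : z ∈ ball (0 : ℂ) 1) : ‖F z‖ ≤ ‖∏ k ∈ s, blaschkeFactor (α k) z‖ := by
  obtain ⟨Q, -, hQ, -, h⟩ := exists_eq_prod_blaschkeFactor_mul hα s univ F hF hb
    (subset_univ _) (by simpa using ho)
  rw [h z hz, norm_mul]
  exact mul_le_of_le_one_right (norm_nonneg _) (hQ z hz)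

/-- The Blaschke condition. -/
theorem summable_one_sub_norm (hα : ∀ k, ‖α k‖ < 1) {F : ℂ → ℂ}
    (hF : DifferentiableOn ℂ F (ball 0 1)) (hb : ∀ z ∈ ball (0 : ℂ) 1, ‖F z‖ ≤ 1)
    (ho : ∀ z ∈ ball (0 : ℂ) 1, {k | α k = z}.encard = analyticOrderAt F z)
    {z₀ : ℂ} (hz₀ : z₀ ∈ ball (0 : ℂ) 1) (h0 : F z₀ ≠ 0) : Summable fun k => 1 - ‖α k‖ := by
  have hz₀' := mem_ball_zero_iff.1 hz₀
  have hpos : ∀ k, 0 < pseudoDist z₀ (α k) := by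
    intro k
    have h1 := norm_le_norm_prod_blaschkeFactor hα hF hb ho {k} hz₀
    rw [Finset.prod_singleton, norm_blaschkeFactor] at h1
    exact (norm_pos_iff.2 h0).trans_le h1
  have hc : 0 ≤ 8 / (1 - ‖z₀‖ ^ 2) := by
    have := one_sub_norm_sq_pos hz₀'
    positivity
  refine summable_of_sum_le (c := 8 / (1 - ‖z₀‖ ^ 2) * -Real.log ‖F z₀‖)
    (fun k => by have := hα k; simp only [Pi.zero_apply]; linarith) fun s => ?_
  calc ∑ k ∈ s, (1 - ‖α k‖)
      -- Uses `1 - ρ ≤ -log ρ`.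
      ≤ ∑ k ∈ s, 8 / (1 - ‖z₀‖ ^ 2) * -Real.log (pseudoDist z₀ (α k)) := by
        refine Finset.sum_le_sum fun k _ =>
          (one_sub_norm_le_one_sub_pseudoDist hz₀' (hα k)).trans ?_
        gcongr
        linarith [Real.log_le_sub_one_of_pos (hpos k)]
    _ = 8 / (1 - ‖z₀‖ ^ 2) * -Real.log (∏ k ∈ s, pseudoDist z₀ (α k)) := by
        rw [← Finset.mul_sum, Finset.sum_neg_distrib, Real.log_prod fun k _ => (hpos k).ne']
    _ ≤ _ := by
        have h1 := norm_le_norm_prod_blaschkeFactor hα hF hb ho s hz₀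
        gcongr
        simpa only [norm_prod, norm_blaschkeFactor] using h1

theorem eventually_le_pseudoDist (hα : ∀ k, ‖α k‖ < 1) (hs : Summable fun k => 1 - ‖α k‖)
    {r δ : ℝ} (hr : r < 1) (hδ : 0 < δ) :
    ∀ᶠ k in cofinite, ∀ z : ℂ, ‖z‖ ≤ r → 1 - δ ≤ pseudoDist z (α k) := by
  have hlim : Tendsto (fun k => 2 * (1 - ‖α k‖) * (2 / (1 - r))) cofinite (𝓝 0) := by
    simpa using (hs.tendsto_cofinite_zero.const_mul 2).mul_const (2 / (1 - r))
  filter_upwards [hlim.eventually_lt_const hδ] with k hk z hz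
  have hz1 : ‖z‖ < 1 := hz.trans_lt hr
  have h1 := one_sub_pseudoDist_sq_le hz1 (hα k)
  have hr' : 0 < 1 - r := by linarith
  have h2 : (1 - ‖α k‖ ^ 2) * (2 / (1 - ‖z‖)) ≤ 2 * (1 - ‖α k‖) * (2 / (1 - r)) := by
    have h3 : 1 - ‖α k‖ ^ 2 ≤ 2 * (1 - ‖α k‖) := by nlinarith [hα k, norm_nonneg (α k)]
    have h4 : 0 ≤ 2 * (1 - ‖α k‖) := by linarith [hα k]
    have h5 : 0 < 1 - ‖z‖ := by linarith
    gcongr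
  nlinarith [pseudoDist_nonneg z (α k), pseudoDist_lt_one hz1 (hα k)]

theorem eventually_le_pseudoDist_of_norm_eq {w : ℂ} (hw : ‖w‖ < 1) {δ : ℝ} (hδ : 0 < δ) :
    ∀ᶠ r : ℝ in 𝓝[<] 1, ∀ z : ℂ, ‖z‖ = r → 1 - δ ≤ pseudoDist z w := by
  have hlim : Tendsto (fun r : ℝ => (1 - r ^ 2) * (2 / (1 - ‖w‖))) (𝓝[<] 1) (𝓝 0) := by
    have : Tendsto (fun r : ℝ => (1 - r ^ 2) * (2 / (1 - ‖w‖))) (𝓝[<] 1)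
        (𝓝 ((1 - 1 ^ 2) * (2 / (1 - ‖w‖)))) :=
      (Continuous.tendsto (by fun_prop) 1).mono_left nhdsWithin_le_nhds
    simpa using this
  filter_upwards [hlim.eventually_lt_const hδ, self_mem_nhdsWithin] with r hr hr1 z hz
  subst hz
  have h1 := one_sub_pseudoDist_sq_le hw hr1
  rw [pseudoDist_comm]
  nlinarith [pseudoDist_nonneg w z, pseudoDist_lt_one hw hr1]

variable {T : ℂ → ℂ}

theorem exists_eq_of_eq_zero (hT : DifferentiableOn ℂ T (ball 0 1))
    (ho : ∀ z ∈ ball (0 : ℂ) 1, {k | α k = z}.encard = analyticOrderAt T z) {z : ℂ}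
    (hz : z ∈ ball (0 : ℂ) 1) (h0 : T z = 0) : ∃ k, α k = z := by
  have h1 : {k | α k = z}.encard ≠ 0 := by
    rw [ho z hz, (hT.analyticAt (isOpen_ball.mem_nhds hz)).analyticOrderAt_ne_zero]
    exact h0
  exact Set.encard_ne_zero.1 h1

theorem eq_zero_of_zeroSequence (hT : DifferentiableOn ℂ T (ball 0 1))
    (hα : ∀ k, ‖α k‖ < 1)
    (ho : ∀ z ∈ ball (0 : ℂ) 1, {k | α k = z}.encard = analyticOrderAt T z) (k : ι) :
    T (α k) = 0 := by
  have hk : α k ∈ ball (0 : ℂ) 1 := mem_ball_zero_iff.2 (hα k)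
  rw [← (hT.analyticAt (isOpen_ball.mem_nhds hk)).analyticOrderAt_ne_zero, ← ho _ hk]
  exact Set.encard_ne_zero.2 ⟨k, rfl⟩

/-- If `T` is large far from its zeros and the zero `α k` is far from the other zeros, then the
quotient of `T` by the Blaschke factor of `α k` is large near `α k`. -/
theorem le_norm_of_eq_blaschkeFactor_mul (hT : DifferentiableOn ℂ T (ball 0 1))
    (hα : ∀ k, ‖α k‖ < 1)
    (ho : ∀ z ∈ ball (0 : ℂ) 1, {k | α k = z}.encard = analyticOrderAt T z)
    {δ ε : ℝ} (hδ : 0 < δ) (hδ1 : δ < 1) (hε1 : ε < 1)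
    (hfar : ∀ z : ℂ, ‖z‖ < 1 → (∀ k, 1 - δ ≤ pseudoDist z (α k)) → 1 - ε ≤ ‖T z‖)
    {k : ι} (hk : ∀ j, j ≠ k → 1 - δ ^ 2 / 4 ≤ pseudoDist (α j) (α k))
    {X : ℂ → ℂ} (hX : DifferentiableOn ℂ X (ball 0 1))
    (hTX : ∀ z ∈ ball (0 : ℂ) 1, T z = blaschkeFactor (α k) z * X z)
    {z : ℂ} (hz : ‖z‖ < 1) (hzk : pseudoDist z (α k) ≤ 1 - δ) : 1 - ε ≤ ‖X z‖ := by
  have hother : ∀ w : ℂ, ‖w‖ < 1 → pseudoDist w (α k) ≤ 1 - δ → ∀ j, j ≠ k →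
      1 - δ ≤ pseudoDist w (α j) := by
    intro w hw hwk j hj
    have h1 := one_sub_pseudoDist_sq_le_mul hw (hα j) (hα k)
    have h2 := hk j hj
    -- The separation `δ² / 4` is chosen so that this bound `δ² / 2`, multiplied by the loss `2 /
    -- δ`, is exactly `δ`.
    have h3 : 1 - pseudoDist (α j) (α k) ^ 2 ≤ δ ^ 2 / 2 := by
      nlinarith [pseudoDist_nonneg (α j) (α k), pseudoDist_lt_one (hα j) (hα k)]
    have h4 : 2 / (1 - pseudoDist w (α k)) ≤ 2 / δ := by
      gcongr
      linarith
    have h5 : (1 - pseudoDist (α j) (α k) ^ 2) * (2 / (1 - pseudoDist w (α k)))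
        ≤ δ ^ 2 / 2 * (2 / δ) := by
      have : 0 ≤ 1 - pseudoDist w (α k) := by linarith
      gcongr
    have h6 : δ ^ 2 / 2 * (2 / δ) = δ := by field_simp
    nlinarith [pseudoDist_nonneg w (α j), pseudoDist_lt_one hw (hα j)]
  have hne : ∀ w : ℂ, ‖w‖ < 1 → pseudoDist w (α k) ≤ 1 - δ → X w ≠ 0 := by
    intro w hw hwk h0
    have hw' : w ∈ ball (0 : ℂ) 1 := mem_ball_zero_iff.2 hw
    by_cases hwa : w = α k
    · have hset : {j | α j = w} = {k} := by
        ext j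
        refine ⟨fun hj => ?_, fun hj => by rw [mem_singleton_iff] at hj; rw [hj, hwa]; rfl⟩
        by_contra hjk
        have h1 := hk j hjk
        rw [show α j = α k from hj.trans hwa, pseudoDist_self] at h1
        nlinarith
      have h1 := ho w hw'
      rw [analyticOrderAt_of_eq_blaschkeFactor_mul hX hTX (hα k) hw, if_pos hwa.symm, hset,
        Set.encard_singleton] at h1
      have h2 : analyticOrderAt X w = 0 :=
        (ENat.add_right_injective_of_ne_top ENat.one_ne_top (by simpa using h1.symm))
      rw [(hX.analyticAt (isOpen_ball.mem_nhds hw')).analyticOrderAt_eq_zero] at h2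
      exact h2 h0
    · obtain ⟨j, hj⟩ := exists_eq_of_eq_zero hT ho hw' (by rw [hTX w hw', h0, mul_zero])
      have h1 := hother w hw hwk j fun hjk => hwa (by rw [← hj, hjk])
      rw [hj, pseudoDist_self] at h1
      linarith
  have hm := mapsTo_discInvolution (hα k)
  have hnorm : ∀ w, ‖w‖ ≤ 1 - δ → ‖discInvolution (α k) w‖ < 1 ∧
      pseudoDist (discInvolution (α k) w) (α k) = ‖w‖ := fun w hw =>
    ⟨norm_discInvolution_lt_one (hα k) (by linarith),
      pseudoDist_discInvolution (hα k) (by linarith)⟩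
  have := le_norm_of_le_norm_sphere (W := X ∘ discInvolution (α k)) (r := 1 - δ) (c := 1 - ε)
    (z := discInvolution (α k) z) (hX.comp (differentiableOn_discInvolution (hα k)) hm)
    (by linarith) (by linarith) (by linarith)
    (fun w hw => by
      obtain ⟨h1, h2⟩ := hnorm w hw
      exact hne _ h1 (by rwa [h2]))
    (fun w hw => by
      obtain ⟨h1, h2⟩ := hnorm w hw.le
      have h3 : 1 - ε ≤ ‖T (discInvolution (α k) w)‖ := by
        refine hfar _ h1 fun j => ?_
        by_cases hj : j = k
        · rw [hj, h2, hw]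
        · exact hother _ h1 (by rw [h2, hw]) j hj
      rw [hTX _ (mem_ball_zero_iff.2 h1), norm_mul, norm_blaschkeFactor] at h3
      refine h3.trans (mul_le_of_le_one_left (norm_nonneg _) (pseudoDist_lt_one h1 (hα k)).le))
    (by rwa [norm_discInvolution])
  rwa [Function.comp_apply, discInvolution_discInvolution (hα k) hz] at this

/-- If `T` is large far from its zeros and the zeros are far from each other, then the quotients of
`T` by large finite subproducts of the Blaschke factors have modulus close to one. -/
theorem exists_finset_le_norm (hT : DifferentiableOn ℂ T (ball 0 1))
    (hα : ∀ k, ‖α k‖ < 1)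
    (ho : ∀ z ∈ ball (0 : ℂ) 1, {k | α k = z}.encard = analyticOrderAt T z)
    (hs : Summable fun k => 1 - ‖α k‖)
    (hsep : ∀ δ : ℝ, 0 < δ → ∀ᶠ k in cofinite, ∀ j, j ≠ k → 1 - δ ≤ pseudoDist (α j) (α k))
    (hfar : ∀ ε : ℝ, 0 < ε → ∃ δ : ℝ, 0 < δ ∧ δ < 1 ∧ ∀ z : ℂ, ‖z‖ < 1 →
      (∀ k, 1 - δ ≤ pseudoDist z (α k)) → 1 - ε ≤ ‖T z‖)
    {ε R : ℝ} (hε : 0 < ε) (hε1 : ε < 1) (hR : R < 1) :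
    ∃ s₀ : Finset ι, ∀ s : Finset ι, s₀ ⊆ s → ∀ Q : ℂ → ℂ, DifferentiableOn ℂ Q (ball 0 1) →
      (∀ z ∈ ball (0 : ℂ) 1, {k ∈ univ \ (s : Set ι) | α k = z}.encard = analyticOrderAt Q z) →
      (∀ z ∈ ball (0 : ℂ) 1, T z = (∏ k ∈ s, blaschkeFactor (α k) z) * Q z) →
      ∀ z : ℂ, ‖z‖ ≤ R → 1 - ε ≤ ‖Q z‖ := by
  classical
  obtain ⟨δ, hδ, hδ1, hA⟩ := hfar ε hε
  have hE : {k | ¬∀ j, j ≠ k → 1 - δ ^ 2 / 4 ≤ pseudoDist (α j) (α k)}.Finite :=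
    hsep (δ ^ 2 / 4) (by positivity)
  have hEr : ∀ᶠ r : ℝ in 𝓝[<] 1, ∀ k ∈ {k | ¬∀ j, j ≠ k → 1 - δ ^ 2 / 4 ≤ pseudoDist (α j) (α k)},
      ∀ z : ℂ, ‖z‖ = r → 1 - δ ≤ pseudoDist z (α k) :=
    (eventually_all_finite hE).2 fun k _ => eventually_le_pseudoDist_of_norm_eq (hα k) hδ
  -- The finitely many zeros that are not isolated are far from the whole circle `|z| = r`, so a
  -- circle point close to a zero is close to an isolated one.
  obtain ⟨r, hr, hrR⟩ := (hEr.and (Ioo_mem_nhdsLT (max_lt hR zero_lt_one))).exists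
  have hRr : R < r := (le_max_left _ _).trans_lt hrR.1
  have hr0 : 0 < r := (le_max_right _ _).trans_lt hrR.1
  have hfin : {k | ¬∀ z : ℂ, ‖z‖ ≤ r → 1 - δ ≤ pseudoDist z (α k)}.Finite :=
    eventually_le_pseudoDist hα hs hrR.2 hδ
  refine ⟨hfin.toFinset, fun s hs₀ Q hQ hoQ hTQ z hz => ?_⟩
  have hnotin : ∀ k, k ∉ s → ∀ z : ℂ, ‖z‖ ≤ r → 1 - δ ≤ pseudoDist z (α k) := by
    intro k hk
    by_contra hcon
    exact hk (hs₀ (hfin.mem_toFinset.2 hcon))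
  refine le_norm_of_le_norm_sphere hQ hr0 hrR.2 (by linarith) (fun w hw h0 => ?_)
    (fun w hw => ?_) (hz.trans hRr.le)
  · have hw' : w ∈ ball (0 : ℂ) 1 := mem_ball_zero_iff.2 (hw.trans_lt hrR.2)
    have h1 : {k ∈ univ \ (s : Set ι) | α k = w}.encard ≠ 0 := by
      rw [hoQ w hw', (hQ.analyticAt (isOpen_ball.mem_nhds hw')).analyticOrderAt_ne_zero]
      exact h0
    obtain ⟨k, hk, hkw⟩ := Set.encard_ne_zero.1 h1
    have h2 := hnotin k (fun h => hk.2 h) w hw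
    rw [hkw, pseudoDist_self] at h2
    linarith
  · have hw1 : ‖w‖ < 1 := hw.trans_lt hrR.2
    have hw' : w ∈ ball (0 : ℂ) 1 := mem_ball_zero_iff.2 hw1
    have hprod : ∀ t : Finset ι, ‖∏ k ∈ t, blaschkeFactor (α k) w‖ ≤ 1 := by
      intro t
      rw [norm_prod]
      refine Finset.prod_le_one (fun _ _ => norm_nonneg _) fun k _ => ?_
      rw [norm_blaschkeFactor]
      exact (pseudoDist_lt_one hw1 (hα k)).le
    by_cases hall : ∀ k, 1 - δ ≤ pseudoDist w (α k)
    · refine (hA w hw1 hall).trans ?_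
      rw [hTQ w hw', norm_mul]
      exact mul_le_of_le_one_left (norm_nonneg _) (hprod s)
    · push Not at hall
      obtain ⟨k, hk⟩ := hall
      have hks : k ∈ s := by
        by_contra hks
        exact hk.not_ge (hnotin k hks w hw.le)
      have hkE : ∀ j, j ≠ k → 1 - δ ^ 2 / 4 ≤ pseudoDist (α j) (α k) := by
        by_contra hcon
        exact hk.not_ge (hr k hcon w hw)
      -- The quotient of `T` by the factor of `α k` alone is `Q` times the remaining factors, each
      -- of modulus at most `1`.
      have h1 := le_norm_of_eq_blaschkeFactor_mul hT hα ho hδ hδ1 hε1 hA hkE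
        (X := fun z => (∏ j ∈ s.erase k, blaschkeFactor (α j) z) * Q z)
        ((DifferentiableOn.fun_finsetProd fun j _ => differentiableOn_blaschkeFactor (hα j)).mul hQ)
        (fun z hz => by
          rw [hTQ z hz, ← Finset.mul_prod_erase s _ hks, mul_assoc])
        hw1 hk.le
      refine h1.trans ?_
      rw [norm_mul]
      exact mul_le_of_le_one_left (norm_nonneg _) (hprod _)

theorem multipliable_blaschkeFactor (hα : ∀ k, ‖α k‖ < 1) (hs : Summable fun k => 1 - ‖α k‖)
    {z : ℂ} (hz : ‖z‖ < 1) : Multipliable fun k => blaschkeFactor (α k) z := by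
  have h1 : Summable fun k => ‖blaschkeFactor (α k) z - 1‖ :=
    Summable.of_nonneg_of_le (fun _ => norm_nonneg _)
      (fun k => by rw [norm_sub_rev]; exact norm_one_sub_blaschkeFactor_le (hα k) hz)
      (hs.mul_right (2 / (1 - ‖z‖)))
  simpa using multipliable_one_add_of_summable h1

theorem exists_eq_const_mul_tprod_blaschkeFactor (hT : DifferentiableOn ℂ T (ball 0 1))
    (hb : ∀ z ∈ ball (0 : ℂ) 1, ‖T z‖ ≤ 1) (hα : ∀ k, ‖α k‖ < 1)
    (ho : ∀ z ∈ ball (0 : ℂ) 1, {k | α k = z}.encard = analyticOrderAt T z)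
    (hs : Summable fun k => 1 - ‖α k‖)
    (hsep : ∀ δ : ℝ, 0 < δ → ∀ᶠ k in cofinite, ∀ j, j ≠ k → 1 - δ ≤ pseudoDist (α j) (α k))
    (hfar : ∀ ε : ℝ, 0 < ε → ∃ δ : ℝ, 0 < δ ∧ δ < 1 ∧ ∀ z : ℂ, ‖z‖ < 1 →
      (∀ k, 1 - δ ≤ pseudoDist z (α k)) → 1 - ε ≤ ‖T z‖)
    {z₀ : ℂ} (hz₀ : z₀ ∈ ball (0 : ℂ) 1) (h0 : T z₀ ≠ 0) :
    ∃ c : ℂ, ‖c‖ = 1 ∧ ∀ z ∈ ball (0 : ℂ) 1, T z = c * ∏' k, blaschkeFactor (α k) z := by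
  have hz₀' := mem_ball_zero_iff.1 hz₀
  choose Q hQ hQb hQo hTQ using fun s : Finset ι => exists_eq_prod_blaschkeFactor_mul hα s univ T hT
    hb (subset_univ _) (by simpa using ho)
  have hP : ∀ z ∈ ball (0 : ℂ) 1, Tendsto (fun s : Finset ι => ∏ k ∈ s, blaschkeFactor (α k) z)
      atTop (𝓝 (∏' k, blaschkeFactor (α k) z)) := fun z hz =>
    (multipliable_blaschkeFactor hα hs (mem_ball_zero_iff.1 hz)).hasProd
  have hP0 : ∏' k, blaschkeFactor (α k) z₀ ≠ 0 := by
    have h1 : ‖T z₀‖ ≤ ‖∏' k, blaschkeFactor (α k) z₀‖ :=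
      ge_of_tendsto (hP z₀ hz₀).norm (Eventually.of_forall fun s =>
        norm_le_norm_prod_blaschkeFactor hα hT hb ho s hz₀)
    exact norm_pos_iff.1 ((norm_pos_iff.2 h0).trans_le h1)
  set c := T z₀ / ∏' k, blaschkeFactor (α k) z₀ with hc
  have hQc : Tendsto (fun s => Q s z₀) atTop (𝓝 c) := by
    refine (Tendsto.div tendsto_const_nhds (hP z₀ hz₀) hP0).congr fun s => ?_
    have h1 : ∏ k ∈ s, blaschkeFactor (α k) z₀ ≠ 0 := by
      intro h; exact h0 (by rw [hTQ s z₀ hz₀, h, zero_mul])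
    exact (div_eq_iff h1).2 ((hTQ s z₀ hz₀).trans (mul_comm _ _))
  have hQ1 : Tendsto (fun s => ‖Q s z₀‖) atTop (𝓝 1) := by
    refine tendsto_order.2 ⟨fun x hx => ?_, fun x hx => ?_⟩
    · obtain ⟨s₀, hs₀⟩ := exists_finset_le_norm hT hα ho hs hsep hfar
        (ε := min (1 - x) 1 / 2) (R := ‖z₀‖)
        (by have : 0 < min (1 - x) 1 := lt_min (by linarith) one_pos
            positivity)
        (by have : min (1 - x) 1 ≤ 1 := min_le_right _ _
            linarith) hz₀'
      filter_upwards [eventually_ge_atTop s₀] with s hs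
      have h1 := hs₀ s hs (Q s) (hQ s) (hQo s) (hTQ s) z₀ le_rfl
      have : min (1 - x) 1 ≤ 1 - x := min_le_left _ _
      linarith
    · exact Eventually.of_forall fun s => (hQb s z₀ hz₀).trans_lt hx
  have hc1 : ‖c‖ = 1 := tendsto_nhds_unique hQc.norm hQ1
  refine ⟨c, hc1, fun z hz => ?_⟩
  have hz' := mem_ball_zero_iff.1 hz
  have hρ : 0 < 1 - pseudoDist z z₀ ^ 2 := by
    nlinarith [pseudoDist_nonneg z z₀, pseudoDist_lt_one hz' hz₀']
  -- Schwarz–Pick for `Q s`: since `1 - |Q s z₀|² → 0`, the values at `z` and `z₀` merge.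
  have hx : Tendsto (fun s => (starRingEnd ℂ) (Q s z₀) * Q s z) atTop (𝓝 1) := by
    have hsq : Tendsto (fun s => ‖1 - (starRingEnd ℂ) (Q s z₀) * Q s z‖ ^ 2) atTop (𝓝 0) := by
      refine squeeze_zero (g := fun s => (1 - ‖Q s z₀‖ ^ 2) / (1 - pseudoDist z z₀ ^ 2))
        (fun s => by positivity) (fun s => ?_) ?_
      · rw [le_div_iff₀ hρ]
        refine (schwarz_pick (hQ s) (hQb s) hz' hz₀').trans (mul_le_of_le_one_left ?_ ?_)
        · nlinarith [hQb s z₀ hz₀, norm_nonneg (Q s z₀)]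
        · nlinarith [norm_nonneg (Q s z)]
      · simpa using ((hQ1.pow 2).const_sub 1).div_const (1 - pseudoDist z z₀ ^ 2)
    have hn : Tendsto (fun s => ‖1 - (starRingEnd ℂ) (Q s z₀) * Q s z‖) atTop (𝓝 0) := by
      simpa using hsq.sqrt
    simpa using (tendsto_zero_iff_norm_tendsto_zero.2 hn).const_sub 1
  have hlim1 : Tendsto (fun s => (starRingEnd ℂ) (Q s z₀) * T z) atTop
      (𝓝 ((starRingEnd ℂ) c * T z)) :=
    ((Complex.continuous_conj.tendsto c).comp hQc).mul_const _
  have hlim2 : Tendsto (fun s => (starRingEnd ℂ) (Q s z₀) * T z) atTop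
      (𝓝 ((∏' k, blaschkeFactor (α k) z) * 1)) := by
    refine ((hP z hz).mul hx).congr fun s => ?_
    rw [hTQ s z hz]
    ring
  have heq := tendsto_nhds_unique hlim1 hlim2
  have hcc : c * (starRingEnd ℂ) c = 1 := by
    rw [Complex.mul_conj', hc1]; simp
  rw [mul_one] at heq
  rw [← heq, ← mul_assoc, hcc, one_mul]

/-- Turns thinness into a statement about the modulus of the quotient at its own removed zero. -/
theorem norm_deriv_of_eq_blaschkeFactor_mul {a : ℂ} (ha : ‖a‖ < 1) {X : ℂ → ℂ}
    (hX : DifferentiableOn ℂ X (ball 0 1))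
    (hTX : ∀ z ∈ ball (0 : ℂ) 1, T z = blaschkeFactor a z * X z) :
    (1 - ‖a‖ ^ 2) * ‖deriv T a‖ = ‖X a‖ := by
  have hnhds : ball (0 : ℂ) 1 ∈ 𝓝 a := isOpen_ball.mem_nhds (mem_ball_zero_iff.2 ha)
  have h1 : T =ᶠ[𝓝 a] fun z => blaschkeFactor a z * X z := by
    filter_upwards [hnhds] with z hz using hTX z hz
  rw [h1.deriv_eq, deriv_fun_mul (analyticAt_blaschkeFactor ha ha).differentiableAt
    (hX.differentiableAt hnhds), blaschkeFactor_self, zero_mul, add_zero, norm_mul,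
    norm_deriv_blaschkeFactor_self ha, mul_inv_cancel_left₀ (one_sub_norm_sq_pos ha).ne']

theorem tendsto_norm_deriv (hT : DifferentiableOn ℂ T (ball 0 1))
    (hb : ∀ z ∈ ball (0 : ℂ) 1, ‖T z‖ ≤ 1) (hα : ∀ k, ‖α k‖ < 1)
    (ho : ∀ z ∈ ball (0 : ℂ) 1, {k | α k = z}.encard = analyticOrderAt T z)
    (hsep : ∀ δ : ℝ, 0 < δ → ∀ᶠ k in cofinite, ∀ j, j ≠ k → 1 - δ ≤ pseudoDist (α j) (α k))
    (hfar : ∀ ε : ℝ, 0 < ε → ∃ δ : ℝ, 0 < δ ∧ δ < 1 ∧ ∀ z : ℂ, ‖z‖ < 1 →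
      (∀ k, 1 - δ ≤ pseudoDist z (α k)) → 1 - ε ≤ ‖T z‖) :
    Tendsto (fun k => (1 - ‖α k‖ ^ 2) * ‖deriv T (α k)‖) cofinite (𝓝 1) := by
  choose X hX hXb hTX using fun k => exists_eq_blaschkeFactor_mul hT hb (hα k)
    (eq_zero_of_zeroSequence hT hα ho k)
  refine tendsto_order.2 ⟨fun x hx => ?_, fun x hx => Eventually.of_forall fun k => ?_⟩
  · have hm : 0 < min (1 - x) 1 := lt_min (by linarith) one_pos
    have hm1 : min (1 - x) 1 ≤ 1 := min_le_right _ _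
    have hm2 : min (1 - x) 1 ≤ 1 - x := min_le_left _ _
    obtain ⟨δ, hδ, hδ1, hA⟩ := hfar (min (1 - x) 1 / 2) (by positivity)
    filter_upwards [hsep (δ ^ 2 / 4) (by positivity)] with k hk
    have h1 := le_norm_of_eq_blaschkeFactor_mul hT hα ho hδ hδ1 (by linarith) hA hk (hX k) (hTX k)
      (hα k) (by rw [pseudoDist_self]; linarith)
    rw [norm_deriv_of_eq_blaschkeFactor_mul (hα k) (hX k) (hTX k)]
    linarith
  · rw [norm_deriv_of_eq_blaschkeFactor_mul (hα k) (hX k) (hTX k)]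
    exact (hXb k _ (mem_ball_zero_iff.2 (hα k))).trans_lt hx

end ZeroSequence

/-- Super-separation only compares indices beyond some `M`. The finitely many earlier points are
fixed, and the Blaschke condition sends `a k` to the circle, away from them. -/
theorem IsSuperSeparated.eventually_le_pseudoDist {N : ℕ∞} {a : SeqIdx N → Disc}
    (hsep : IsSuperSeparated a) (hs : Summable fun k => 1 - ‖(a k : ℂ)‖) {δ : ℝ} (hδ : 0 < δ) :
    ∀ᶠ k in cofinite, ∀ j, j ≠ k → 1 - δ ≤ pseudoDist (a j) (a k) := by
  have ha : ∀ k, ‖(a k : ℂ)‖ < 1 := fun k => mem_ball_zero_iff.1 (a k).2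
  obtain ⟨M, hM⟩ := hsep δ hδ
  have hfin : {k : SeqIdx N | (k : ℕ) < M}.Finite :=
    (Set.finite_lt_nat M).preimage Subtype.val_injective.injOn
  have h1 : ∀ᶠ k in cofinite, ∀ j ∈ {k : SeqIdx N | (k : ℕ) < M},
      1 - δ ≤ pseudoDist (a j) (a k) := by
    refine (eventually_all_finite hfin).2 fun j _ => ?_
    filter_upwards [_root_.eventually_le_pseudoDist (α := fun k => (a k : ℂ)) ha hs (ha j) hδ]
      with k hk using hk _ le_rfl
  filter_upwards [h1, hfin.compl_mem_cofinite] with k hk hkM j hj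
  have hkM' : M ≤ (k : ℕ) := not_lt.1 hkM
  rcases lt_or_ge (j : ℕ) M with hjM | hjM
  · exact hk j hjM
  · rcases lt_or_gt_of_ne (fun h => hj (Subtype.ext h) : (j : ℕ) ≠ k) with h | h
    · rw [pseudoDist_comm]
      exact hM k j hjM h
    · exact hM j k hkM' h

/-- A zero-free inner divisor of an inner function whose modulus is that of the Blaschke product of
its zeros is constant. -/
theorem IsBlaschkeProduct.hasNoSingularFactor {Θ : HInf} (hΘ : IsInner Θ) {N : ℕ∞}
    {a : SeqIdx N → Disc} (ha : IsZeroSequence Θ a) (hB : IsBlaschkeProduct Θ a) :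
    HasNoSingularFactor Θ := by
  intro S hS hS0 ⟨g, hg⟩
  obtain ⟨z₀, hz₀, h0⟩ := hΘ.exists_eval_ne_zero
  obtain ⟨-, c, hc, hP⟩ := hB
  have hΘg : ∀ z ∈ ball (0 : ℂ) 1, HInf.eval Θ z = HInf.eval S z * HInf.eval g z := fun z hz => by
    rw [hg, HInf.eval_mul _ _ hz]
  have hSne : ∀ z ∈ ball (0 : ℂ) 1, HInf.eval S z ≠ 0 := fun z hz h =>
    (Set.mem_empty_iff_false z).1 (hS0 ▸ (⟨hz, h⟩ : z ∈ zeroSet S))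
  have hgb := hS.norm_le_one_of_norm_mul_le_one (HInf.differentiableOn_eval g)
    (fun z hz => HInf.norm_eval_le g hz) fun z hz => by
      rw [mul_comm, ← hΘg z hz]; exact hΘ.norm_eval_le_one z hz
  have hgo : ∀ z ∈ ball (0 : ℂ) 1,
      {k | (a k : ℂ) = z}.encard = analyticOrderAt (HInf.eval g) z := by
    intro z hz
    have hnhds := isOpen_ball.mem_nhds hz
    have h1 : HInf.eval Θ =ᶠ[𝓝 z] HInf.eval S * HInf.eval g := by
      filter_upwards [hnhds] with w hw using hΘg w hw
    have hSa := (HInf.differentiableOn_eval S).analyticAt hnhds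
    have h2 := ha ⟨z, hz⟩
    rw [analyticOrderAt_congr h1, analyticOrderAt_mul hSa
      ((HInf.differentiableOn_eval g).analyticAt hnhds), hSa.analyticOrderAt_eq_zero.2 (hSne z hz),
      zero_add] at h2
    simpa only [Subtype.ext_iff] using h2
  -- As `S` is zero-free, `g` has the zeros of `Θ`, so it is dominated by their Blaschke product,
  -- whose modulus is `|Θ| = |S| |g|`. This forces `|S(z₀)| = 1`.
  have hgP : ‖HInf.eval g z₀‖ ≤ ‖∏' k, blaschkeFactor (a k) z₀‖ := by
    have hlim : Tendsto (fun s => ∏ k ∈ s, blaschkeFactor (a k) z₀) atTop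
        (𝓝 (∏' k, blaschkeFactor (a k) z₀)) := (hP z₀ hz₀).1.hasProd
    exact ge_of_tendsto hlim.norm (Eventually.of_forall fun s =>
      norm_le_norm_prod_blaschkeFactor (fun k => mem_ball_zero_iff.1 (a k).2)
        (HInf.differentiableOn_eval g) hgb hgo s hz₀)
  have hgpos : 0 < ‖HInf.eval g z₀‖ := by
    refine norm_pos_iff.2 fun h => h0 ?_
    rw [hΘg z₀ hz₀, h, mul_zero]
  have hS1 : ‖HInf.eval S z₀‖ = 1 := by
    refine le_antisymm (hS.norm_eval_le_one z₀ hz₀) ?_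
    have h1 := congrArg norm (hP z₀ hz₀).2
    rw [norm_mul, hc, one_mul, hΘg z₀ hz₀, norm_mul] at h1
    rw [← h1] at hgP
    exact le_of_mul_le_mul_right (by rwa [one_mul]) hgpos
  refine ⟨HInf.eval S z₀, fun z hz => ?_⟩
  have hz' := mem_ball_zero_iff.1 hz
  have hz₀' := mem_ball_zero_iff.1 hz₀
  have hsp := schwarz_pick (HInf.differentiableOn_eval S) hS.norm_eval_le_one hz' hz₀'
  have hρ : 0 < 1 - pseudoDist z z₀ ^ 2 := by
    nlinarith [pseudoDist_nonneg z z₀, pseudoDist_lt_one hz' hz₀']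
  rw [hS1, one_pow, sub_self, mul_zero] at hsp
  have h1 : 1 - (starRingEnd ℂ) (HInf.eval S z₀) * HInf.eval S z = 0 := by
    by_contra hne
    have := norm_pos_iff.2 hne
    exact hsp.not_gt (by positivity)
  have h2 : HInf.eval S z₀ * (starRingEnd ℂ) (HInf.eval S z₀) = 1 := by
    rw [Complex.mul_conj', hS1]; simp
  linear_combination -HInf.eval S z₀ * h1 - HInf.eval S z * h2

theorem proposition6p2 (Θ : HInf) (hΘ : IsInner Θ) (N : ℕ∞) (a : SeqIdx N → Disc)
    (ha : IsZeroSequence Θ a) (hsep : IsSuperSeparated a) (hSIP : SharpInvertibility Θ) :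
    IsThinBlaschkeProduct Θ a ∧ HasNoSingularFactor Θ := by
  have hα : ∀ k, ‖(a k : ℂ)‖ < 1 := fun k => mem_ball_zero_iff.1 (a k).2
  have hT := HInf.differentiableOn_eval Θ
  have hb := hΘ.norm_eval_le_one
  have ho : ∀ z ∈ ball (0 : ℂ) 1,
      {k | (a k : ℂ) = z}.encard = analyticOrderAt (HInf.eval Θ) z := by
    intro z hz
    simpa only [Subtype.ext_iff] using ha ⟨z, hz⟩
  obtain ⟨z₀, hz₀, h0⟩ := hΘ.exists_eval_ne_zero
  have hs := summable_one_sub_norm hα hT hb ho hz₀ h0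
  have hsep' : ∀ δ : ℝ, 0 < δ → ∀ᶠ k in cofinite, ∀ j, j ≠ k →
      1 - δ ≤ pseudoDist (a j) (a k) := fun δ hδ => hsep.eventually_le_pseudoDist hs hδ
  have hfar : ∀ ε : ℝ, 0 < ε → ∃ δ : ℝ, 0 < δ ∧ δ < 1 ∧ ∀ z : ℂ, ‖z‖ < 1 →
      (∀ k, 1 - δ ≤ pseudoDist z (a k)) → 1 - ε ≤ ‖HInf.eval Θ z‖ := by
    intro ε hε
    obtain ⟨δ, hδ, hA⟩ := hSIP.exists_le_norm_eval hΘ hε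
    -- The SIP gives no upper bound on `δ`; the later pseudohyperbolic radius `1 - δ` must be
    -- positive.
    refine ⟨min δ (1 / 2), by positivity, (min_le_right _ _).trans_lt (by norm_num),
      fun z hz h => hA z hz fun ζ hζ => ?_⟩
    obtain ⟨k, rfl⟩ := exists_eq_of_eq_zero hT ho hζ.1 hζ.2
    linarith [h k, min_le_left δ (1 / 2)]
  obtain ⟨c, hc, hP⟩ :=
    exists_eq_const_mul_tprod_blaschkeFactor hT hb hα ho hs hsep' hfar hz₀ h0
  have hB : IsBlaschkeProduct Θ a := ⟨hs, c, hc, fun z hz =>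
    ⟨multipliable_blaschkeFactor hα hs (mem_ball_zero_iff.1 hz), hP z hz⟩⟩
  exact ⟨⟨hB, tendsto_norm_deriv hT hb hα ho hsep' hfar⟩, hB.hasNoSingularFactor hΘ ha⟩
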